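/- Conventions. Let $G$ be a graph with vertex set $V(G)$; all numbers below are cardinals, and $|G|=|V(G)|$. The motion $m(G)$ is the least number of vertices moved by a non-identity automorphism of $G$; if $G$ has no non-identity automorphism, then $m(G)$ is by convention larger than every cardinal. $\Delta(G)$ is the least upper bound of the degrees of the vertices of $G$. A set $S\subseteq V(G)$ is asymmetrizing if the identity is the only automorphism $\varphi$ of $G$ with $\varphi(S)=S$; two asymmetrizing sets $S,S'$ of $G$ are equivalent if $\varphi(S)=S'$ for some automorphism $\varphi$ of $G$; and $a(G)$ is the number of equivalence classes of asymmetrizing sets of $G$. A double ray is a two-way infinite path. Theorem. Let $m$ be an infinite cardinal and let $T$ be a tree with motion $m(T)\ge m$ and $\Delta(T)\le 2^{m}$. If $T$ contains a double ray, then $a(T)=2^{|T|}$. -/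

import Mathlib

open Cardinal

universe u

namespace TreeAsym

variable {V : Type u}

/-- The set of vertices moved by an automorphism `φ` of the graph `G`. -/
def moved {G : SimpleGraph V} (φ : G ≃g G) : Set V := {v | φ v ≠ v}

/-- The motion of a graph: the least number of vertices moved by a non-identity automorphism.
It takes values in the cardinals with a top element added; an asymmetric graph (one with no
non-identity automorphism) has motion `⊤`, which is larger than every cardinal. -/
noncomputable def motion (G : SimpleGraph V) : WithTop Cardinal.{u} :=
  ⨅ φ : {φ : G ≃g G // φ ≠ SimpleGraph.Iso.refl}, ((#(moved φ.1) : Cardinal.{u}) : WithTop Cardinal.{u})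

/-- The least upper bound of the (cardinal) degrees of the vertices of `G`. (The family of degrees
is indexed by the small type `V`, so it is always bounded above.) -/
noncomputable def maxDeg (G : SimpleGraph V) : Cardinal.{u} := ⨆ v : V, #(G.neighborSet v)

/-- `G` contains a double ray, i.e. a two-way infinite path. -/
def HasDoubleRay (G : SimpleGraph V) : Prop :=
  ∃ r : ℤ → V, Function.Injective r ∧ ∀ i : ℤ, G.Adj (r i) (r (i + 1))

/-- `S` is asymmetrizing: the identity is the only automorphism that fixes `S` setwise. -/
def IsAsymmetrizing (G : SimpleGraph V) (S : Set V) : Prop :=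
  ∀ φ : G ≃g G, φ '' S = S → φ = SimpleGraph.Iso.refl

/-- Equivalence of asymmetrizing sets: some automorphism of `G` maps one onto the other. -/
def asymSetoid (G : SimpleGraph V) : Setoid {S : Set V // IsAsymmetrizing G S} where
  r S S' := ∃ φ : G ≃g G, φ '' S.1 = S'.1
  iseqv :=
    { refl := fun S => ⟨SimpleGraph.Iso.refl, Set.image_id S.1⟩
      symm := by
        rintro S S' ⟨φ, h⟩
        refine ⟨φ.symm, ?_⟩
        rw [← h, Set.image_image]
        simp
      trans := by
        rintro S S' S'' ⟨φ, h⟩ ⟨ψ, h'⟩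
        refine ⟨φ.trans ψ, ?_⟩
        rw [← h', ← h, Set.image_image]
        rfl }

/-- The asymmetrizing number `a(G)`: the number of pairwise inequivalent asymmetrizing sets. -/
noncomputable def asymNumber (G : SimpleGraph V) : Cardinal.{u} := #(Quotient (asymSetoid G))

end TreeAsym

/-! The upper bound is trivial. For the lower bound, root the tree at a vertex `r` of a double ray.
The trunk, formed by the vertices from which a ray leads away from `r`, is then the union of all
double rays, hence invariant under every automorphism, and the branches hanging off it are rayless.
Motion enters through `le_mk_below`: a branch at a vertex that a root-fixing automorphism moves to a
sibling has at least `m` vertices, while at most `2 ^ m` siblings compete.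

On rayless branches a well-founded recursion works (`two_power_hangSet_le`): siblings in one orbit
must receive inequivalent rigid colourings, and there are enough of these to give each sibling its
own supply without loss in number. So a trunk vertex `v` with a set `H_v` hanging off it has `2 ^
(ℵ₀ + |H_v|)` possible colours: a rigid colouring of its hanging branches, and a sequence of bits to
be stored further down the trunk.

The trunk has no bottom from which to recurse. There one counts partial rigid labels, which may stop
anywhere. Below a vertex where their number is least among large branches, this number is constant
on large branches, so the product bound holds to every finite depth, and sequences of labels number
at least `2 ^ m` (`two_power_le_mk_seq`). `exists_rigid_coloring` glues such sequences into
countably many trunk colourings without a common nontrivial symmetry. As `(2 ^ κ) ^ ℵ₀ = 2 ^ κ` for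
infinite `κ`, all of them fit into one colour per trunk vertex, together with a free parameter of
equally many values. `paint` turns this into a set of vertices from which the root and the colours
can be recovered. Different parameters give inequivalent asymmetrizing sets, and there are `∏ 2 ^
(ℵ₀ + |H_v|) ≥ 2 ^ |T|` of them. -/

namespace TreeAsym

/-! ### Rooted forests, labels and their types -/

/-- A rooted forest, given by its child relation, together with a group of permutations preserving
it and an invariant assignment of allowed colours. -/
structure Forest (V α : Type u) where
  ch : V → V → Prop
  depth : V → ℕ
  par : V → V
  par_eq : ∀ {p c}, ch p c → par c = p
  depth_eq : ∀ {p c}, ch p c → depth c = depth p + 1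
  A : Subgroup (Equiv.Perm V)
  map_ch : ∀ {φ}, φ ∈ A → ∀ {p c}, ch p c → ch (φ p) (φ c)
  C : V → Set α
  nonempty_C : ∀ v, (C v).Nonempty
  map_C : ∀ {φ}, φ ∈ A → ∀ v, C (φ v) = C v

namespace Forest

variable {V α : Type u} (F : Forest V α)

/-- `u` is a descendant of `v`. -/
def Desc (v u : V) : Prop := Relation.ReflTransGen F.ch v u

/-- `u` is joined to its ancestor `v` by a path all of whose vertices below `v` are marked. -/
inductive Reach (k : V → Prop × α) (v : V) : V → Prop
  | refl : Reach k v v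
  | step {p c : V} : Reach k v p → F.ch p c → (k c).1 → Reach k v c

/-- `φ` carries the marked part of `k` below `v` onto the marked part of `k'` below `φ v`,
respecting colours. -/
def Match (φ : Equiv.Perm V) (k k' : V → Prop × α) (v : V) : Prop :=
  ∀ u, F.Reach k v u → (k u).2 = (k' (φ u)).2 ∧ ∀ c, F.ch u c → ((k c).1 ↔ (k' (φ c)).1)

variable {F}

theorem ch_symm_apply {φ : Equiv.Perm V} (hφ : φ ∈ F.A) {p c : V} (h : F.ch p c) :
    F.ch (φ.symm p) (φ.symm c) := F.map_ch (F.A.inv_mem hφ) h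

theorem Reach.desc {k : V → Prop × α} {v u : V} (h : F.Reach k v u) : F.Desc v u := by
  induction h with
  | refl => exact Relation.ReflTransGen.refl
  | step _ h _ ih => exact ih.tail h

theorem Match.reach {φ : Equiv.Perm V} (hφ : φ ∈ F.A) {k k' : V → Prop × α} {v u : V}
    (h : F.Match φ k k' v) (hu : F.Reach k v u) : F.Reach k' (φ v) (φ u) := by
  induction hu with
  | refl => exact .refl
  | step h1 h2 h3 ih => exact ih.step (F.map_ch hφ h2) (((h _ h1).2 _ h2).1 h3)

theorem Match.reach_symm {φ : Equiv.Perm V} (hφ : φ ∈ F.A) {k k' : V → Prop × α} {v u : V}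
    (h : F.Match φ k k' v) (hu : F.Reach k' (φ v) u) : F.Reach k v (φ.symm u) := by
  induction hu with
  | refl => simpa using Reach.refl
  | step h1 h2 h3 ih =>
    have h2' := ch_symm_apply hφ h2
    exact ih.step h2' (((h _ ih).2 _ h2').2 (by simpa using h3))

theorem Match.refl (k : V → Prop × α) (v : V) : F.Match 1 k k v :=
  fun _ _ => ⟨rfl, fun _ _ => Iff.rfl⟩

theorem Match.symm {φ : Equiv.Perm V} (hφ : φ ∈ F.A) {k k' : V → Prop × α} {v : V}
    (h : F.Match φ k k' v) : F.Match φ⁻¹ k' k (φ v) := by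
  intro u hu
  have h1 := h _ (h.reach_symm hφ hu)
  refine ⟨by simpa using h1.1.symm, fun c hc => ?_⟩
  have := h1.2 _ (ch_symm_apply hφ hc)
  simpa using this.symm

theorem Match.trans {φ ψ : Equiv.Perm V} (hφ : φ ∈ F.A) {k k' k'' : V → Prop × α} {v : V}
    (h : F.Match φ k k' v) (h' : F.Match ψ k' k'' (φ v)) : F.Match (ψ * φ) k k'' v := by
  intro u hu
  have h1 := h _ hu
  have h2 := h' _ (h.reach hφ hu)
  exact ⟨h1.1.trans h2.1, fun c hc => (h1.2 c hc).trans (h2.2 _ (F.map_ch hφ hc))⟩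

theorem Match.transport (φ : Equiv.Perm V) (k : V → Prop × α) (v : V) :
    F.Match φ k (k ∘ φ.symm) v := by
  intro u _
  simp

variable (F) in
/-- Labels at vertices, up to the matching relation. -/
def typeSetoid : Setoid (V × (V → Prop × α)) where
  r x y := ∃ φ ∈ F.A, φ x.1 = y.1 ∧ F.Match φ x.2 y.2 x.1
  iseqv :=
    { refl := fun x => ⟨1, F.A.one_mem, rfl, Match.refl _ _⟩
      symm := by
        rintro x y ⟨φ, h, h1, h2⟩
        refine ⟨φ⁻¹, F.A.inv_mem h, by simp [← h1], ?_⟩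
        rw [← h1]
        exact h2.symm h
      trans := by
        rintro x y z ⟨φ, h, h1, h2⟩ ⟨ψ, h', h1', h2'⟩
        refine ⟨ψ * φ, F.A.mul_mem h' h, by simp [h1, h1'], ?_⟩
        rw [← h1] at h2'
        exact h2.trans h h2' }

variable (F) in
/-- The type of labels up to matching. -/
abbrev LabelType := Quotient F.typeSetoid

variable (F) in
/-- The type of the label `k` at `v`. -/
def typ (v : V) (k : V → Prop × α) : F.LabelType := Quotient.mk F.typeSetoid (v, k)

theorem typ_eq {v v' : V} {k k' : V → Prop × α} :
    F.typ v k = F.typ v' k' ↔ ∃ φ ∈ F.A, φ v = v' ∧ F.Match φ k k' v :=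
  Quotient.eq (r := F.typeSetoid)

/-- A label is admissible at `v` if its colours are allowed, and every symmetry fixing `v` and
matching the label with itself fixes its marked part; a full label marks all descendants. -/
structure Adm (F : Forest V α) (full : Prop) (v : V) (k : V → Prop × α) : Prop where
  col : ∀ u, (k u).2 ∈ F.C u
  rigid : ∀ φ ∈ F.A, φ v = v → F.Match φ k k v → ∀ u, F.Reach k v u → φ u = u
  reach : full → ∀ u, F.Desc v u → F.Reach k v u

/-- The types of the admissible labels at `v`. -/
def T (F : Forest V α) (full : Prop) (v : V) : Set F.LabelType :=
  {q | ∃ k, F.Adm full v k ∧ F.typ v k = q}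

variable {full : Prop}

theorem Desc.map {φ : Equiv.Perm V} (hφ : φ ∈ F.A) {v u : V} (h : F.Desc v u) :
    F.Desc (φ v) (φ u) := by
  induction h with
  | refl => exact Relation.ReflTransGen.refl
  | tail _ h ih => exact ih.tail (F.map_ch hφ h)

theorem Adm.transport {φ : Equiv.Perm V} (hφ : φ ∈ F.A) {v : V} {k : V → Prop × α}
    (h : F.Adm full v k) : F.Adm full (φ v) (k ∘ φ.symm) where
  col u := by
    have := h.col (φ.symm u)
    rwa [show φ.symm u = φ⁻¹ u from rfl, F.map_C (F.A.inv_mem hφ)] at this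
  rigid ψ hψ h1 h2 u hu := by
    have m1 := Match.transport (F := F) φ k v
    have m2 := m1.trans hφ h2
    rw [← h1] at hu
    have m3 := m1.symm hφ
    have m4 : F.Match (φ⁻¹ * (ψ * φ)) k k v := by
      refine m2.trans (F.A.mul_mem hψ hφ) ?_
      have : (ψ * φ) v = φ v := h1
      rw [this]
      exact m3
    have := h.rigid _ (F.A.mul_mem (F.A.inv_mem hφ) (F.A.mul_mem hψ hφ)) (by simp [h1]) m4 (φ.symm u)
      (m1.reach_symm hφ (by rwa [h1] at hu))
    have := congrArg φ this
    simpa using this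
  reach hf u hu := by
    have h1 := h.reach hf (φ.symm u) (by simpa using hu.map (F.A.inv_mem hφ))
    simpa using (Match.transport (F := F) φ k v).reach hφ h1

theorem T_subset {φ : Equiv.Perm V} (hφ : φ ∈ F.A) (v : V) : F.T full v ⊆ F.T full (φ v) := by
  rintro q ⟨k, hk, rfl⟩
  exact ⟨_, hk.transport hφ, (typ_eq.2 ⟨φ, hφ, rfl, Match.transport φ k v⟩).symm⟩

/-- Siblings in one orbit have the same set of types. Hence a choice made as a function of this set
alone is automatically the same for both; this device recurs below. -/
theorem T_map {φ : Equiv.Perm V} (hφ : φ ∈ F.A) (v : V) : F.T full (φ v) = F.T full v := by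
  refine (T_subset hφ v).antisymm' ?_
  simpa using T_subset (full := full) (F.A.inv_mem hφ) (φ v)

theorem Desc.depth_le {v u : V} (h : F.Desc v u) : F.depth v ≤ F.depth u := by
  induction h with
  | refl => exact le_rfl
  | tail _ h ih => rw [F.depth_eq h]; omega

theorem iterate_par_of_desc {v u : V} (h : F.Desc v u) :
    F.par^[F.depth u - F.depth v] u = v := by
  induction h with
  | refl => simp
  | tail h1 h ih =>
    have h2 : F.Desc v _ := h1
    rw [F.depth_eq h, Nat.succ_sub h2.depth_le, Function.iterate_succ_apply, F.par_eq h, ih]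

theorem ne_of_ch_of_desc {p c u : V} (h : F.ch p c) (hu : F.Desc c u) : u ≠ p := by
  rintro rfl
  have := hu.depth_le
  rw [F.depth_eq h] at this
  omega

theorem ne_of_desc_of_ch {c u x : V} (hu : F.Desc c u) (h : F.ch u x) : x ≠ c := by
  rintro rfl
  have := hu.depth_le
  rw [F.depth_eq h] at this
  omega

/-! ### Building a label from labels at the children -/

open Classical in
/-- The label at `p` with colour `a` at `p`, in which the child `c` is marked and carries the
label `G c` if this is defined, and is unmarked otherwise. -/
noncomputable def comb (F : Forest V α) (p : V) (a : α) (G : V → Option (V → Prop × α)) (u : V) :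
    Prop × α :=
  if u = p then (False, a) else
    -- The iterate is the child of `p` above `u`.
    match G (F.par^[F.depth u - (F.depth p + 1)] u) with
    | none => (False, (F.nonempty_C u).some)
    -- A label ignores the mark at its own top vertex, so the mark at the child must be set here.
    | some k => (u = F.par^[F.depth u - (F.depth p + 1)] u ∨ (k u).1, (k u).2)

section comb

variable {p : V} {a : α} {G : V → Option (V → Prop × α)}

theorem comb_self : (F.comb p a G p).2 = a := by simp [comb]

theorem comb_none {c : V} (h : F.ch p c) (hG : G c = none) : ¬ (F.comb p a G c).1 := by
  have h1 := ne_of_ch_of_desc h Relation.ReflTransGen.refl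
  simp [comb, h1, F.depth_eq h, hG]

theorem comb_some {c u : V} {k : V → Prop × α} (h : F.ch p c) (hu : F.Desc c u)
    (hG : G c = some k) : F.comb p a G u = (u = c ∨ (k u).1, (k u).2) := by
  have h1 := ne_of_ch_of_desc h hu
  have h2 := iterate_par_of_desc hu
  rw [F.depth_eq h] at h2
  simp [comb, h1, h2, hG]

theorem comb_child_iff {c : V} (h : F.ch p c) : (F.comb p a G c).1 ↔ (G c).isSome := by
  cases hG : G c with
  | none => simpa using comb_none h hG
  | some k => simp [comb_some h Relation.ReflTransGen.refl hG]

theorem comb_mem (ha : a ∈ F.C p) (hG : ∀ c k, G c = some k → ∀ u, (k u).2 ∈ F.C u) (u : V) :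
    (F.comb p a G u).2 ∈ F.C u := by
  unfold comb
  split_ifs with h
  · subst h; exact ha
  · split
    · exact (F.nonempty_C u).some_mem
    · rename_i k hk
      exact hG _ k hk u

theorem reach_comb {c u : V} {k : V → Prop × α} (h : F.ch p c) (hG : G c = some k)
    (hu : F.Reach k c u) : F.Reach (F.comb p a G) p u := by
  induction hu with
  | refl => exact Reach.refl.step h (by simp [comb_child_iff h, hG])
  | step h1 h2 h3 ih =>
    refine ih.step h2 ?_
    rw [comb_some h (h1.desc.tail h2) hG]
    exact Or.inr h3

theorem reach_comb_iff {u : V} : F.Reach (F.comb p a G) p u ↔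
    u = p ∨ ∃ c k, F.ch p c ∧ G c = some k ∧ F.Reach k c u := by
  constructor
  · intro h
    induction h with
    | refl => exact Or.inl rfl
    | @step x y h1 h2 h3 ih =>
      right
      rcases ih with rfl | ⟨c, k, hc, hG, hx⟩
      · rw [comb_child_iff h2, Option.isSome_iff_exists] at h3
        obtain ⟨k, hk⟩ := h3
        exact ⟨y, k, h2, hk, .refl⟩
      · refine ⟨c, k, hc, hG, hx.step h2 ?_⟩
        rw [comb_some hc (hx.desc.tail h2) hG] at h3
        exact h3.resolve_left (ne_of_desc_of_ch hx.desc h2)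
  · rintro (rfl | ⟨c, k, h, hG, hu⟩)
    · exact .refl
    · exact reach_comb h hG hu

theorem Match.of_comb {φ : Equiv.Perm V} (hφ : φ ∈ F.A) (hp : φ p = p) {a' : α}
    {G' : V → Option (V → Prop × α)} (h : F.Match φ (F.comb p a G) (F.comb p a' G') p) :
    a = a' ∧ ∀ c, F.ch p c → ((G c).isSome ↔ (G' (φ c)).isSome) ∧
      ∀ k k', G c = some k → G' (φ c) = some k' → F.Match φ k k' c := by
  have h0 := h p .refl
  refine ⟨by simpa [hp, comb_self] using h0.1, fun c hc => ?_⟩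
  have hc' : F.ch p (φ c) := by simpa [hp] using F.map_ch hφ hc
  refine ⟨?_, fun k k' hk hk' u hu => ?_⟩
  · rw [← comb_child_iff (a := a) hc, ← comb_child_iff (a := a') hc']
    exact h0.2 c hc
  · have h1 := h u (reach_comb hc hk hu)
    have h2 : F.Desc (φ c) (φ u) := hu.desc.map hφ
    rw [comb_some hc hu.desc hk, comb_some hc' h2 hk'] at h1
    refine ⟨h1.1, fun x hx => ?_⟩
    have h3 := h1.2 x hx
    rw [comb_some hc (hu.desc.tail hx) hk, comb_some hc' (h2.tail (F.map_ch hφ hx)) hk'] at h3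
    have h4 := ne_of_desc_of_ch hu.desc hx
    have h5 := ne_of_desc_of_ch h2 (F.map_ch hφ hx)
    simpa [h4, h5] using h3

end comb

open Classical in
/-- An admissible label of type `q` at `v`, if there is one. -/
noncomputable def lab (F : Forest V α) (full : Prop) (v : V) (q : F.LabelType) : V → Prop × α :=
  if h : q ∈ F.T full v then h.choose else fun u => (False, (F.nonempty_C u).some)

theorem adm_lab {v : V} {q : F.LabelType} (h : q ∈ F.T full v) : F.Adm full v (F.lab full v q) := by
  rw [lab, dif_pos h]; exact h.choose_spec.1

theorem typ_lab {v : V} {q : F.LabelType} (h : q ∈ F.T full v) : F.typ v (F.lab full v q) = q := by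
  rw [lab, dif_pos h]; exact h.choose_spec.2

/-- The combination of labels of prescribed types at the children of `p`. -/
noncomputable def tcomb (F : Forest V α) (full : Prop) (p : V) (a : α)
    (y : V → Option F.LabelType) : V → Prop × α :=
  F.comb p a fun c => (y c).map (F.lab full c)

section tcomb

variable {p : V} {a a' : α} {y y' : V → Option F.LabelType}

theorem Match.of_tcomb {φ : Equiv.Perm V} (hφ : φ ∈ F.A) (hp : φ p = p)
    (hy : ∀ c q, y c = some q → q ∈ F.T full c) (hy' : ∀ c q, y' c = some q → q ∈ F.T full c)
    (h : F.Match φ (F.tcomb full p a y) (F.tcomb full p a' y') p) :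
    a = a' ∧ ∀ c, F.ch p c → y' (φ c) = y c := by
  obtain ⟨h1, h2⟩ := h.of_comb hφ hp
  refine ⟨h1, fun c hc => ?_⟩
  obtain ⟨h3, h4⟩ := h2 c hc
  cases hq : y c with
  | none => simpa [hq] using h3
  | some q =>
    obtain ⟨q', hq'⟩ : ∃ q', y' (φ c) = some q' := by
      simpa [hq, Option.isSome_iff_exists] using h3
    have h5 := h4 (F.lab full c q) (F.lab full (φ c) q') (by simp [hq]) (by simp [hq'])
    rw [hq', ← typ_lab (hy _ _ hq), ← typ_lab (hy' _ _ hq')]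
    exact congrArg some (typ_eq.2 ⟨φ, hφ, rfl, h5⟩).symm

theorem adm_tcomb (ha : a ∈ F.C p) (hy : ∀ c q, y c = some q → q ∈ F.T full c)
    (hfull : full → ∀ c, F.ch p c → (y c).isSome)
    (hinj : ∀ c c' q, F.ch p c → F.ch p c' → y c = some q → y c' = some q →
      (∃ φ ∈ F.A, φ p = p ∧ φ c = c') → c = c') :
    F.Adm full p (F.tcomb full p a y) where
  col := by
    refine comb_mem ha fun c k hk => ?_
    obtain ⟨q, hq, rfl⟩ := Option.map_eq_some_iff.1 hk
    exact (adm_lab (hy c q hq)).col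
  rigid φ hφ hp h u hu := by
    rcases reach_comb_iff.1 hu with rfl | ⟨c, k, hc, hk, hr⟩
    · exact hp
    · obtain ⟨q, hq, rfl⟩ := Option.map_eq_some_iff.1 hk
      have h1 := (h.of_tcomb hφ hp hy hy).2 c hc
      have hc' : F.ch p (φ c) := by simpa [hp] using F.map_ch hφ hc
      have h2 : φ c = c := (hinj c (φ c) q hc hc' hq (h1.trans hq) ⟨φ, hφ, hp, rfl⟩).symm
      have h3 := ((h.of_comb hφ hp).2 c hc).2 _ _ hk (by rw [h2]; exact hk)
      exact (adm_lab (hy c q hq)).rigid φ hφ h2 h3 u hr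
  reach hf u hu := by
    rcases Relation.ReflTransGen.cases_head hu with rfl | ⟨c, hc, hcu⟩
    · exact .refl
    · obtain ⟨q, hq⟩ := Option.isSome_iff_exists.1 (hfull hf c hc)
      exact reach_comb_iff.2 (Or.inr ⟨c, F.lab full c q, hc, by simp [hq],
        (adm_lab (hy c q hq)).reach hf u hcu⟩)

/-- If a given type never occurs at two different siblings of one orbit, even across two indices,
then a match between combined labels can carry no marked child to another one. So the labels are
rigid, and equal types force equal data. -/
theorem le_mk_T {I : Type u} (p : V) (a : I → α) (y : I → V → Option F.LabelType)
    (ha : ∀ i, a i ∈ F.C p) (hy : ∀ i c q, y i c = some q → q ∈ F.T full c)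
    (hfull : full → ∀ i c, F.ch p c → (y i c).isSome)
    (hinj : ∀ i j c c' q, F.ch p c → F.ch p c' → y i c = some q → y j c' = some q →
      (∃ φ ∈ F.A, φ p = p ∧ φ c = c') → c = c')
    (hne : ∀ i j, a i = a j → (∀ c, F.ch p c → y i c = y j c) → i = j) :
    #I ≤ #(F.T full p) := by
  have hadm : ∀ i, F.Adm full p (F.tcomb full p (a i) (y i)) := fun i =>
    adm_tcomb (ha i) (hy i) (fun hf => hfull hf i) (hinj i i)
  refine mk_le_of_injective (f := fun i => (⟨F.typ p (F.tcomb full p (a i) (y i)),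
    _, hadm i, rfl⟩ : F.T full p)) fun i j hij => ?_
  obtain ⟨φ, hφ, hp, h⟩ := typ_eq.1 (congrArg Subtype.val hij)
  obtain ⟨h1, h2⟩ := h.of_tcomb hφ hp (hy i) (hy j)
  refine hne i j h1 fun c hc => ?_
  have hc' : F.ch p (φ c) := by simpa [hp] using F.map_ch hφ hc
  cases hq : y i c with
  | some q =>
    have h3 := h2 c hc
    have h4 : c = φ c := hinj i j c (φ c) q hc hc' hq (h3.trans hq) ⟨φ, hφ, hp, rfl⟩
    rw [← h4] at h3
    rw [h3, hq]
  | none =>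
    cases hq' : y j c with
    | none => rfl
    | some q =>
      have hp' : φ.symm p = p := by rw [Equiv.symm_apply_eq, hp]
      have hc0 : F.ch p (φ.symm c) := by simpa [hp'] using ch_symm_apply hφ hc
      have h3 := h2 _ hc0
      rw [Equiv.apply_symm_apply, hq'] at h3
      have h4 := hinj i j _ c q hc0 hc h3.symm hq' ⟨φ, hφ, hp, by simp⟩
      rw [h4, hq] at h3
      cases h3

end tcomb

/-! ### Lower bounds for the number of types -/

theorem mk_C_le (p : V) : #(F.C p) ≤ #(F.T False p) :=
  le_mk_T p (fun a : F.C p => a.1) (fun _ _ => none) (fun a => a.2) (by simp) (by simp) (by simp)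
    fun _ _ h _ => Subtype.ext h

/-- Mark only the child `c` and vary its type; this needs labels that are not full. -/
theorem mk_T_le_of_ch {p c : V} (h : F.ch p c) : #(F.T False c) ≤ #(F.T False p) := by
  classical
  refine le_mk_T (I := F.T False c) p (fun _ => (F.nonempty_C p).some)
    (fun i c' => if c' = c then some i.1 else none)
    (fun _ => (F.nonempty_C p).some_mem) ?_ (by simp) ?_ ?_
  · intro i c' q hq
    split_ifs at hq with hc
    subst hc
    cases hq
    exact i.2
  · intro i j c1 c2 q _ _ h1 h2 _
    split_ifs at h1 h2 with h3 h4
    rw [h3, h4]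
  · intro i j _ hij
    exact Subtype.ext (by simpa using hij c h)

theorem mk_T_le_of_desc {v u : V} (h : F.Desc v u) : #(F.T False u) ≤ #(F.T False v) := by
  induction h with
  | refl => exact le_rfl
  | tail _ h ih => exact (mk_T_le_of_ch h).trans ih

/-- Reserve distinct types for the members of `Y`; each subset of `Y`, taken as the set of marked
children, then gives a different type at `p`. -/
theorem two_power_le_mk_T {p : V} {Y : Set V} (hY : ∀ c ∈ Y, F.ch p c)
    (hc : ∀ c ∈ Y, #Y ≤ #(F.T False c)) : 2 ^ #Y ≤ #(F.T False p) := by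
  classical
  -- The injection depends only on the set of types, so members of one orbit use the same injection
  -- and receive distinct types.
  have : ∀ S : Set F.LabelType, ∃ e : Y → F.LabelType, #Y ≤ #S →
      Function.Injective e ∧ ∀ x, e x ∈ S := by
    intro S
    by_cases h : #Y ≤ #S
    · obtain ⟨e⟩ := h
      exact ⟨fun x => e x, fun _ => ⟨fun x x' hx => e.injective (Subtype.ext hx), fun x => (e x).2⟩⟩
    · exact ⟨fun x => F.typ x fun u => (False, (F.nonempty_C u).some), fun h' => absurd h' h⟩
  choose e he using this
  rw [← mk_set]
  refine le_mk_T (I := Set Y) p (fun _ => (F.nonempty_C p).some)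
    (fun Z c => if h : ∃ h : c ∈ Y, ⟨c, h⟩ ∈ Z then some (e (F.T False c) ⟨c, h.1⟩) else none)
    (fun _ => (F.nonempty_C p).some_mem) ?_ (by simp) ?_ ?_
  · intro Z c q hq
    split_ifs at hq with h
    cases hq
    exact (he _ (hc c h.1)).2 _
  · rintro Z Z' c c' q - - h1 h2 ⟨φ, hφ, -, rfl⟩
    split_ifs at h1 h2 with h3 h4
    rw [T_map hφ, ← h1] at h2
    exact congrArg Subtype.val ((he _ (hc c h3.1)).1 (Option.some.inj h2)).symm
  · intro Z Z' _ h
    ext ⟨c, hcY⟩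
    have := h c (hY c hcY)
    by_cases h1 : (⟨c, hcY⟩ : Y) ∈ Z <;> by_cases h2 : (⟨c, hcY⟩ : Y) ∈ Z' <;>
      simp_all

/-- The children of `p` moved by some symmetry fixing `p`. -/
def NF (F : Forest V α) (p : V) : Set V := {c | F.ch p c ∧ ∃ φ ∈ F.A, φ p = p ∧ φ c ≠ c}

theorem mem_NF_of_ne {p c c' : V} (hc : F.ch p c) (h : ∃ φ ∈ F.A, φ p = p ∧ φ c = c')
    (hne : c ≠ c') : c ∈ F.NF p ∧ c' ∈ F.NF p := by
  obtain ⟨φ, hφ, hp, rfl⟩ := h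
  refine ⟨⟨hc, φ, hφ, hp, hne.symm⟩, by simpa [hp] using F.map_ch hφ hc, φ⁻¹, F.A.inv_mem hφ, ?_, ?_⟩
  · exact Equiv.Perm.inv_eq_iff_eq.2 hp.symm
  · simpa using hne

/-- An infinite set of types at least as large as the set of movable children can absorb the name of
the child: `NF p × T c` embeds in `T c`. Arbitrary choices at the children thus become choices that
distinguish siblings. -/
theorem prod_le_mk_T {p : V}
    (h : ∀ c ∈ F.NF p, ℵ₀ ≤ #(F.T full c) ∧ #(F.NF p) ≤ #(F.T full c)) :
    #(F.C p) * Cardinal.prod (fun c : {c // F.ch p c} => #(F.T full c.1)) ≤ #(F.T full p) := by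
  classical
  have : ∀ S : Set F.LabelType, ∃ e : F.NF p → F.LabelType → F.LabelType,
      ℵ₀ ≤ #S → #(F.NF p) ≤ #S → (∀ n, ∀ t ∈ S, e n t ∈ S) ∧
        ∀ n n', ∀ t ∈ S, ∀ t' ∈ S, e n t = e n' t' → n = n' ∧ t = t' := by
    intro S
    by_cases hS : ℵ₀ ≤ #S ∧ #(F.NF p) ≤ #S
    · have : #(F.NF p × S) ≤ #S := by
        rw [mk_prod, lift_id, lift_id]
        exact (mul_le_mul_left hS.2 _).trans (mul_eq_self hS.1).le
      obtain ⟨e⟩ := this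
      refine ⟨fun n t => if ht : t ∈ S then e (n, ⟨t, ht⟩) else t, fun _ _ => ⟨?_, ?_⟩⟩
      · intro n t ht
        simp only [dif_pos ht]
        exact (e _).2
      · intro n n' t ht t' ht' hh
        simp only [dif_pos ht, dif_pos ht'] at hh
        have := e.injective (Subtype.ext hh)
        simpa using this
    · exact ⟨fun _ t => t, fun h1 h2 => absurd ⟨h1, h2⟩ hS⟩
  choose e he using this
  rw [← mk_pi]
  refine (mul_def _ _).le.trans ?_
  let y : (∀ c : {c // F.ch p c}, F.T full c.1) → V → Option F.LabelType := fun i c =>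
    if hc : F.ch p c then
      some (if hn : c ∈ F.NF p then e (F.T full c) ⟨c, hn⟩ (i ⟨c, hc⟩) else i ⟨c, hc⟩)
    else none
  refine le_mk_T (I := F.C p × (∀ c : {c // F.ch p c}, F.T full c.1)) p (fun i => i.1.1)
    (fun i => y i.2) (fun i => i.1.2) ?_ ?_ ?_ ?_
  · intro i c q hq
    simp only [y] at hq
    split_ifs at hq with h1 h2
    · cases hq
      exact (he _ (h c h2).1 (h c h2).2).1 _ _ (i.2 ⟨c, h1⟩).2
    · cases hq
      exact (i.2 ⟨c, h1⟩).2
  · intro _ i c hc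
    simp [y, hc]
  · intro i j c c' q hc hc' h1 h2 hex
    by_contra hne
    obtain ⟨hn, hn'⟩ := mem_NF_of_ne hc hex hne
    obtain ⟨φ, hφ, -, rfl⟩ := hex
    simp only [y, dif_pos hc, dif_pos hc', dif_pos hn, dif_pos hn'] at h1 h2
    have hm : (j.2 ⟨φ c, hc'⟩).1 ∈ F.T full c := by
      rw [← T_map hφ]; exact (j.2 ⟨φ c, hc'⟩).2
    generalize (j.2 ⟨φ c, hc'⟩).1 = t at h2 hm
    rw [← h1, T_map hφ] at h2
    have := ((he _ (h c hn).1 (h c hn).2).2 _ _ _ hm _ (i.2 ⟨c, hc⟩).2 (Option.some.inj h2)).1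
    exact hne (congrArg Subtype.val this).symm
  · rintro ⟨a, i⟩ ⟨a', j⟩ ha hij
    refine Prod.ext (Subtype.ext ha) (funext fun ⟨c, hc⟩ => Subtype.ext ?_)
    have h1 := hij c hc
    simp only [y, dif_pos hc, Option.some.injEq] at h1
    split_ifs at h1 with hn
    · exact ((he _ (h c hn).1 (h c hn).2).2 _ _ _ (i ⟨c, hc⟩).2 _ (j ⟨c, hc⟩).2 h1).2
    · exact h1

/-! ### Sequences of types in forests without a bottom -/

/-- The total weight of the descendants `n` levels below a vertex. -/
noncomputable def levelWeight (F : Forest V α) (w : V → Cardinal.{u}) : ℕ → V → Cardinal.{u}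
  | 0, v => w v
  | n + 1, v => Cardinal.sum fun c : {c // F.ch v c} => F.levelWeight w n c.1

/-- A single label is only shown to carry the weight of each single level. The bound `m` is on the
sum over all levels, so a sequence of labels, one for each level, is needed. -/
theorem two_power_le_mk_seq {w : V → Cardinal.{u}} (hw : ∀ v, ℵ₀ ≤ w v)
    (hC : ∀ v, 2 ^ w v ≤ #(F.C v)) {m : Cardinal.{u}} {large : V → Prop}
    (hup : ∀ p c, F.ch p c → large c → large p) (hNF : ∀ p, ∀ c ∈ F.NF p, large c)
    (hm : ∀ v, large v → m ≤ Cardinal.sum fun n : ℕ => F.levelWeight w n v)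
    {c : V} (hc : large c) : 2 ^ m ≤ #(ℕ → F.T False c) := by
  -- Take a large descendant with the least number of types. As this number can only drop on going
  -- down, it is constant on the large vertices below `u`.
  obtain ⟨ν, ⟨u, hcu, hu, rfl⟩, hmin⟩ := (wellFounded_lt (α := Cardinal.{u})).has_min
    {κ | ∃ u, F.Desc c u ∧ large u ∧ #(F.T False u) = κ} ⟨_, c, Relation.ReflTransGen.refl, hc, rfl⟩
  have hconst : ∀ x, F.Desc u x → large x → #(F.T False x) = #(F.T False u) := fun x hx hl =>
    (mk_T_le_of_desc hx).antisymm (not_lt.1 (hmin _ ⟨x, hcu.trans hx, hl, rfl⟩))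
  have hinf : ∀ x, ℵ₀ ≤ #(F.T False x) := fun x =>
    (((hw x).trans (cantor _).le).trans (hC x)).trans (mk_C_le x)
  have hprod : ∀ x, F.Desc u x → ∀ y ∈ F.NF x,
      ℵ₀ ≤ #(F.T False y) ∧ #(F.NF x) ≤ #(F.T False y) := by
    intro x hx y hy
    refine ⟨hinf y, ?_⟩
    rw [hconst y (hx.tail hy.1) (hNF x y hy)]
    -- Otherwise some set of movable children has exactly as many members as `u` has types; its
    -- subsets would give `x` more types than `u`, against constancy.
    by_contra hlt
    obtain ⟨Y, hY, hYc⟩ := le_mk_iff_exists_subset.1 (not_le.1 hlt).le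
    have h1 := two_power_le_mk_T (F := F) (p := x) (Y := Y) (fun z hz => (hY hz).1) fun z hz => by
      rw [hYc, hconst z (hx.tail (hY hz).1) (hNF x z (hY hz))]
    rw [hYc, hconst x hx (hup x y hy.1 (hNF x y hy))] at h1
    exact (cantor _).not_ge h1
  have hlev : ∀ n x, F.Desc u x → 2 ^ F.levelWeight w n x ≤ #(F.T False x) := by
    intro n
    induction n with
    | zero => exact fun x _ => (hC x).trans (mk_C_le x)
    | succ n ih =>
      intro x hx
      rw [levelWeight, power_sum]
      refine (prod_le_prod _ _ fun y : {y // F.ch x y} => ih y.1 (hx.tail y.2)).trans ?_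
      refine le_trans ?_ (prod_le_mk_T (hprod x hx))
      refine le_mul_of_one_le_left zero_le ?_
      rw [Cardinal.one_le_iff_ne_zero, mk_ne_zero_iff]
      exact (F.nonempty_C x).to_subtype
  calc (2 : Cardinal.{u}) ^ m ≤ 2 ^ Cardinal.sum fun n : ℕ => F.levelWeight w n u :=
        power_le_power_left two_ne_zero (hm u hu)
    _ = Cardinal.prod fun n : ℕ => 2 ^ F.levelWeight w n u := power_sum _ _
    _ ≤ Cardinal.prod fun _ : ℕ => #(F.T False c) :=
        prod_le_prod _ _ fun n => (hlev n u Relation.ReflTransGen.refl).trans (mk_T_le_of_desc hcu)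
    _ = #(ℕ → F.T False c) := by rw [mk_pi]

/-! ### Spreading labels to colourings of the whole forest -/

/-- Extend labels down the forest: a vertex marked in the label of its parent inherits this label,
and any other vertex starts afresh. -/
noncomputable def spread (F : Forest V α) (l : V → V → Prop × α) : ℕ → V → V → Prop × α
  | 0, v => l v
  | n + 1, v =>
    open Classical in
    if (F.spread l n (F.par v) v).1 then F.spread l n (F.par v) else l v

/-- The label of `v` when labels are spread from the root `r`. -/
noncomputable def inherited (F : Forest V α) (l : V → V → Prop × α) (r v : V) : V → Prop × α :=
  F.spread l (F.depth v - F.depth r) v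

/-- The colouring determined by spreading labels from the root `r`. -/
noncomputable def spreadColor (F : Forest V α) (l : V → V → Prop × α) (r v : V) : Prop × α :=
  ((F.inherited l r (F.par v) v).1, (F.inherited l r v v).2)

section spread

variable {l : V → V → Prop × α} {r : V}

theorem inherited_root : F.inherited l r r = l r := by simp [inherited, spread]

open Classical in
theorem inherited_child {p c : V} (hp : F.Desc r p) (hc : F.ch p c) :
    F.inherited l r c = if (F.inherited l r p c).1 then F.inherited l r p else l c := by
  have h : F.depth c - F.depth r = (F.depth p - F.depth r) + 1 := by
    have := hp.depth_le
    rw [F.depth_eq hc]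
    omega
  rw [inherited, h, spread, F.par_eq hc]
  rfl

theorem inherited_of_reach {v u : V} (hv : F.Desc r v) (hu : F.Reach (F.inherited l r v) v u) :
    F.inherited l r u = F.inherited l r v := by
  induction hu with
  | refl => rfl
  | step h1 h2 h3 ih =>
    rw [inherited_child (hv.trans h1.desc) h2, ih, if_pos h3]

theorem exists_inherited {v : V} (hv : F.Desc r v) : ∃ x, F.Desc r x ∧ F.Desc x v ∧
    F.inherited l r x = l x ∧ F.inherited l r v = l x ∧ F.Reach (l x) x v := by
  induction hv with
  | refl => exact ⟨r, .refl, .refl, inherited_root, inherited_root, .refl⟩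
  | @tail p c hp hc ih =>
    by_cases h : (F.inherited l r p c).1
    · obtain ⟨x, h1, h2, h3, h4, h5⟩ := ih
      refine ⟨x, h1, h2.tail hc, h3, ?_, h5.step hc (by rwa [h4] at h)⟩
      rw [inherited_child hp hc, if_pos h, h4]
    · have h' : F.inherited l r c = l c := by rw [inherited_child hp hc, if_neg h]
      exact ⟨c, hp.tail hc, .refl, h', h', .refl⟩

theorem match_spreadColor {v : V} (hv : F.Desc r v) :
    F.Match 1 (F.inherited l r v) (F.spreadColor l r) v := by
  intro u hu
  have h := inherited_of_reach hv hu
  refine ⟨by simp [spreadColor, h], fun x hx => ?_⟩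
  simp [spreadColor, F.par_eq hx, h]

theorem match_inherited {v : V} (hv : F.Desc r v) {φ : Equiv.Perm V} (hφ : φ ∈ F.A) (hr : φ r = r)
    (h : ∀ u, F.Desc r u → F.spreadColor l r (φ u) = F.spreadColor l r u) :
    F.Match φ (F.inherited l r v) (F.inherited l r (φ v)) v := by
  have h2 : F.Match φ (F.spreadColor l r) (F.spreadColor l r) v := by
    intro u hu
    have hd := hv.trans hu.desc
    exact ⟨by rw [h u hd], fun c hc => by rw [h c (hd.tail hc)]⟩
  have hv' : F.Desc r (φ v) := by simpa [hr] using hv.map hφ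
  have h1 := (match_spreadColor (l := l) hv).trans F.A.one_mem h2
  have h3 := (match_spreadColor (l := l) hv').symm F.A.one_mem
  rw [mul_one] at h1
  rw [inv_one] at h3
  have h4 := h1.trans hφ h3
  rwa [one_mul] at h4

end spread

theorem apply_eq_of_desc {φ : Equiv.Perm V} (hφ : φ ∈ F.A) {v u : V} (h : F.Desc v u)
    (hu : φ u = u) : φ v = v := by
  induction h with
  | refl => exact hu
  | tail _ hc ih =>
    refine ih ?_
    have := F.par_eq (F.map_ch hφ hc)
    rw [hu, F.par_eq hc] at this
    exact this.symm

/-- If the sequences of label types separate the movable siblings, then there is a sequence of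
colourings preserved by no nontrivial symmetry. -/
theorem exists_rigid_coloring {r : V} (hr : ∀ φ ∈ F.A, φ r = r)
    (h : ∀ p, ∀ c ∈ F.NF p, #(F.NF p) ≤ #(ℕ → F.T False c)) :
    ∃ f : ℕ → V → Prop × α, (∀ n v, (f n v).2 ∈ F.C v) ∧
      ∀ φ ∈ F.A, (∀ n v, F.Desc r v → f n (φ v) = f n v) → ∀ v, F.Desc r v → φ v = v := by
  classical
  have hne : ∀ v, (F.T False v).Nonempty := fun v => by
    have := mk_C_le (F := F) v
    rw [← Set.nonempty_coe_sort, ← mk_ne_zero_iff]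
    intro h0
    rw [h0, nonpos_iff_eq_zero, mk_eq_zero_iff] at this
    exact this.elim ⟨_, (F.nonempty_C v).some_mem⟩
  have : ∀ (p : V) (S : Set F.LabelType), ∃ e : F.NF p → ℕ → F.LabelType,
      #(F.NF p) ≤ #(ℕ → S) → Function.Injective e ∧ ∀ x n, e x n ∈ S := by
    intro p S
    by_cases hS : #(F.NF p) ≤ #(ℕ → S)
    · obtain ⟨e⟩ := hS
      refine ⟨fun x n => e x n, fun _ => ⟨fun x y hxy => e.injective ?_, fun x n => (e x n).2⟩⟩
      funext n
      exact Subtype.ext (congrFun hxy n)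
    · exact ⟨fun _ _ => (hne p).some, fun h' => absurd h' hS⟩
  choose e he using this
  -- Movable siblings get distinct sequences within an orbit; elsewhere the type is irrelevant and
  -- any available one serves.
  let τ : V → ℕ → F.LabelType := fun c n =>
    if hc : c ∈ F.NF (F.par c) then e (F.par c) (F.T False c) ⟨c, hc⟩ n else (hne c).some
  have hτ : ∀ c n, τ c n ∈ F.T False c := by
    intro c n
    by_cases hc : c ∈ F.NF (F.par c)
    · simp only [τ, dif_pos hc]
      exact (he _ _ (h _ c hc)).2 _ _
    · simp only [τ, dif_neg hc]
      exact (hne c).some_mem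
  have hτe : ∀ {p : V} c n (hc : c ∈ F.NF p), τ c n = e p (F.T False c) ⟨c, hc⟩ n := by
    intro p c n hc
    obtain rfl := F.par_eq hc.1
    simp only [τ, dif_pos hc]
  let l : ℕ → V → V → Prop × α := fun n c => F.lab False c (τ c n)
  have hl : ∀ n c, F.Adm False c (l n c) := fun n c => adm_lab (hτ c n)
  refine ⟨fun n => F.spreadColor (l n) r, ?_, ?_⟩
  · intro n v
    have : ∀ k x u, (F.spread (l n) k x u).2 ∈ F.C u := by
      intro k
      induction k with
      | zero => exact fun x u => (hl n x).col u
      | succ k ih =>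
        intro x u
        rw [spread]
        split_ifs
        · exact ih _ _
        · exact (hl n x).col u
    exact this _ _ _
  · intro φ hφ hf v hv
    induction hv with
    | refl => exact hr φ hφ
    | @tail p c hp hc ih =>
      replace hp : F.Desc r p := hp
      -- If some label reaches from `p` to `c`, its rigidity fixes `c`. If none does, fresh labels
      -- start at `c` and at `φ c` in every colouring, so their type sequences agree, and these
      -- separate movable siblings.
      by_cases hb : ∃ n, (F.inherited (l n) r p c).1
      · obtain ⟨n, hb⟩ := hb
        obtain ⟨x, hx, hxp, h1, h2, h3⟩ := exists_inherited (l := l n) hp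
        have hφx : φ x = x := apply_eq_of_desc hφ hxp ih
        have hM := match_inherited hx hφ (hr φ hφ) (hf n)
        rw [hφx, h1] at hM
        rw [h2] at hb
        exact (hl n x).rigid φ hφ hφx hM c (h3.step hc hb)
      · have hb : ∀ n, ¬ (F.inherited (l n) r p c).1 := not_exists.1 hb
        have hc' : F.ch p (φ c) := by simpa [ih] using F.map_ch hφ hc
        have h1 : ∀ n, F.inherited (l n) r c = l n c := fun n => by
          rw [inherited_child hp hc, if_neg (hb n)]
        have h2 : ∀ n, F.inherited (l n) r (φ c) = l n (φ c) := fun n => by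
          have h3 := congrArg Prod.fst (hf n c (hp.tail hc))
          simp only [spreadColor, F.par_eq hc, F.par_eq hc'] at h3
          rw [inherited_child hp hc', if_neg]
          rw [h3]
          exact hb n
        have h3 : τ c = τ (φ c) := by
          funext n
          have hM := match_inherited (hp.tail hc) hφ (hr φ hφ) (hf n)
          rw [h1, h2] at hM
          rw [← typ_lab (hτ c n), ← typ_lab (hτ (φ c) n)]
          exact typ_eq.2 ⟨φ, hφ, rfl, hM⟩
        by_contra hne
        obtain ⟨hn, hn'⟩ := mem_NF_of_ne hc ⟨φ, hφ, ih, rfl⟩ (Ne.symm hne)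
        have h4 : e p (F.T False c) ⟨c, hn⟩ = e p (F.T False c) ⟨φ c, hn'⟩ := by
          funext n
          have h5 := congrFun h3 n
          rwa [hτe c n hn, hτe _ n hn', T_map hφ] at h5
        exact hne (congrArg Subtype.val ((he _ _ (h _ c hn)).1 h4)).symm

end Forest

/-! ### Trees as rooted forests, and the effect of motion -/

variable {V : Type u} {G : SimpleGraph V}

/-- `c` is a child of `p` in the tree `G` rooted at `r`. -/
def Child (G : SimpleGraph V) (r p c : V) : Prop := G.Adj p c ∧ G.dist r c = G.dist r p + 1

theorem Child.unique (hG : G.IsTree) {r p p' c : V} (h : Child G r p c) (h' : Child G r p' c) :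
    p = p' := by
  obtain ⟨w, hw⟩ := hG.connected.exists_walk_length_eq_dist r p
  obtain ⟨w', hw'⟩ := hG.connected.exists_walk_length_eq_dist r p'
  have h1 : (w.concat h.1).IsPath :=
    SimpleGraph.Walk.isPath_of_length_eq_dist _ (by rw [SimpleGraph.Walk.length_concat, hw, h.2])
  have h2 : (w'.concat h'.1).IsPath :=
    SimpleGraph.Walk.isPath_of_length_eq_dist _ (by rw [SimpleGraph.Walk.length_concat, hw', h'.2])
  have h3 := congrArg SimpleGraph.Walk.penultimate
    (congrArg Subtype.val ((hG.isAcyclic.subsingleton_path r c).elim ⟨_, h1⟩ ⟨_, h2⟩))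
  simpa using h3

theorem adj_iff_child (hG : G.IsTree) {r u v : V} :
    G.Adj u v ↔ Child G r u v ∨ Child G r v u := by
  constructor
  · intro h
    rcases hG.dist_eq_dist_add_one_of_adj r h with h1 | h1
    · exact Or.inr ⟨h.symm, h1⟩
    · exact Or.inl ⟨h, h1⟩
  · rintro (h | h)
    · exact h.1
    · exact h.1.symm

theorem exists_child (hG : G.IsTree) {r v : V} (hv : v ≠ r) : ∃ p, Child G r p v := by
  obtain ⟨w, hw⟩ := hG.connected.exists_walk_length_eq_dist v r
  cases w with
  | nil => exact absurd rfl hv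
  | @cons _ p _ h w =>
    refine ⟨p, h.symm, ?_⟩
    have h1 := SimpleGraph.dist_le w
    rw [SimpleGraph.Walk.length_cons] at hw
    rw [SimpleGraph.dist_comm (v := v), SimpleGraph.dist_comm (v := p)]
    rcases hG.dist_eq_dist_add_one_of_adj r h with h2 | h2 <;>
      rw [SimpleGraph.dist_comm (u := r), SimpleGraph.dist_comm (u := r)] at h2 <;> omega

theorem desc_root (hG : G.IsTree) (r v : V) : Relation.ReflTransGen (Child G r) r v := by
  induction hn : G.dist r v generalizing v with
  | zero =>
    rw [hG.connected.dist_eq_zero_iff] at hn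
    rw [hn]
  | succ n ih =>
    have hv : v ≠ r := by rintro rfl; simp at hn
    obtain ⟨p, hp⟩ := exists_child hG hv
    exact (ih p (by have := hp.2; omega)).tail hp

/-- The automorphisms of `G` fixing `r`, as permutations. -/
def rootedAut (G : SimpleGraph V) (r : V) : Subgroup (Equiv.Perm V) where
  carrier := {φ | φ r = r ∧ ∀ u v, G.Adj (φ u) (φ v) ↔ G.Adj u v}
  mul_mem' {φ ψ} h h' := ⟨by simp [h.1, h'.1], fun u v => by simp [h.2, h'.2]⟩
  one_mem' := ⟨rfl, fun _ _ => Iff.rfl⟩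
  inv_mem' {φ} h := ⟨by rw [Equiv.Perm.inv_eq_iff_eq, h.1], fun u v => by
    rw [← h.2]; simp⟩

theorem dist_map_le (hG : G.Connected) (f : G →g G) (u v : V) : G.dist (f u) (f v) ≤ G.dist u v := by
  obtain ⟨w, hw⟩ := hG.exists_walk_length_eq_dist u v
  have := SimpleGraph.dist_le (w.map f)
  rwa [SimpleGraph.Walk.length_map, hw] at this

theorem dist_rootedAut (hG : G.Connected) {r : V} {φ : Equiv.Perm V} (hφ : φ ∈ rootedAut G r)
    (v : V) : G.dist r (φ v) = G.dist r v := by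
  have key : ∀ {ψ : Equiv.Perm V}, ψ ∈ rootedAut G r → ∀ v, G.dist r (ψ v) ≤ G.dist r v := by
    intro ψ hψ v
    have := dist_map_le hG ⟨ψ, fun {a b} h => (hψ.2 a b).2 h⟩ r v
    simpa [hψ.1] using this
  refine (key hφ v).antisymm ?_
  simpa using key (Subgroup.inv_mem _ hφ) (φ v)

theorem Child.map (hG : G.Connected) {r : V} {φ : Equiv.Perm V} (hφ : φ ∈ rootedAut G r)
    {p c : V} (h : Child G r p c) : Child G r (φ p) (φ c) :=
  ⟨(hφ.2 _ _).2 h.1, by rw [dist_rootedAut hG hφ, dist_rootedAut hG hφ, h.2]⟩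

open Classical in
/-- The parent of a vertex in the tree rooted at `r`. -/
noncomputable def parent (G : SimpleGraph V) (r c : V) : V :=
  if h : ∃ p, Child G r p c then h.choose else c

theorem parent_eq (hG : G.IsTree) {r p c : V} (h : Child G r p c) : parent G r c = p := by
  have h' : ∃ p, Child G r p c := ⟨p, h⟩
  rw [parent, dif_pos h']
  exact h'.choose_spec.unique hG h

/-- The forest whose edges are the edges of `G` leading away from the root `r` into `D`. -/
noncomputable def graphForest (hG : G.IsTree) (r : V) {α : Type u} (D : Set V)
    (hD : ∀ φ ∈ rootedAut G r, ∀ v, v ∈ D → φ v ∈ D) (C : V → Set α)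
    (hne : ∀ v, (C v).Nonempty) (hC : ∀ φ ∈ rootedAut G r, ∀ v, C (φ v) = C v) : Forest V α where
  ch p c := Child G r p c ∧ c ∈ D
  depth := G.dist r
  par := parent G r
  par_eq h := parent_eq hG h.1
  depth_eq h := h.1.2
  A := rootedAut G r
  map_ch hφ _ _ h := ⟨h.1.map hG.connected hφ, hD _ hφ _ h.2⟩
  C := C
  nonempty_C := hne
  map_C hφ v := hC _ hφ v

/-- `u` lies in the branch of the vertex `v`. -/
abbrev Below (G : SimpleGraph V) (r v u : V) : Prop := Relation.ReflTransGen (Child G r) v u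

theorem Below.map (hG : G.Connected) {r : V} {φ : Equiv.Perm V} (hφ : φ ∈ rootedAut G r)
    {v u : V} (h : Below G r v u) : Below G r (φ v) (φ u) := by
  induction h with
  | refl => exact .refl
  | tail _ h ih => exact ih.tail (h.map hG hφ)

theorem Below.dist_le {r v u : V} (h : Below G r v u) : G.dist r v ≤ G.dist r u := by
  induction h with
  | refl => exact le_rfl
  | tail _ h ih => have := h.2; omega

theorem Below.eq_of_dist_eq (hG : G.IsTree) {r v v' u : V} (h : Below G r v u)
    (h' : Below G r v' u) (hd : G.dist r v = G.dist r v') : v = v' := by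
  induction h with
  | refl =>
    rcases Relation.ReflTransGen.cases_tail h' with h1 | ⟨x, h1, h2⟩
    · exact h1
    · have := Below.dist_le h1
      have := h2.2
      omega
  | @tail x u h1 h2 ih =>
    rcases Relation.ReflTransGen.cases_tail h' with h3 | ⟨y, h3, h4⟩
    · subst h3
      have := Below.dist_le h1
      have := h2.2
      omega
    · obtain rfl := h2.unique hG h4
      exact ih h3

/-- If an automorphism moves a vertex to a sibling, then the branches at these vertices can be
interchanged, so that the motion bounds the size of such a branch from below. -/
theorem le_mk_below (hG : G.IsTree) {m : Cardinal.{u}} (hm : ℵ₀ ≤ m)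
    (hmotion : (m : WithTop Cardinal.{u}) ≤ motion G) {r p c : V} (hc : Child G r p c)
    {φ : Equiv.Perm V} (hφ : φ ∈ rootedAut G r) (hp : φ p = p) (hne : φ c ≠ c) :
    m ≤ #{u | Below G r c u} := by
  classical
  set B := {u | Below G r c u} with hB
  set B' := {u | Below G r (φ c) u} with hB'
  have hcc : G.dist r (φ c) = G.dist r c := dist_rootedAut hG.connected hφ c
  have hdisj : ∀ u, u ∈ B → u ∉ B' := fun u h h' => hne (Below.eq_of_dist_eq hG h' h hcc)
  have hto : ∀ u, u ∈ B → φ u ∈ B' := fun u h => Below.map hG.connected hφ h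
  have hfrom : ∀ u, u ∈ B' → φ.symm u ∈ B := fun u h => by
    have := Below.map hG.connected (Subgroup.inv_mem _ hφ) h
    change Below G r c (φ.symm u)
    simpa using this
  -- Exchange the two branches by `φ` and its inverse, and fix everything else.
  let f : V → V := fun u => if u ∈ B then φ u else if u ∈ B' then φ.symm u else u
  have f1 : ∀ u, u ∈ B → f u = φ u := fun u h => by simp [f, h]
  have f2 : ∀ u, u ∈ B' → f u = φ.symm u := fun u h => by
    have : u ∉ B := fun h' => hdisj u h' h
    simp [f, h, this]
  have f3 : ∀ u, u ∉ B → u ∉ B' → f u = u := fun u h h' => by simp [f, h, h']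
  have hf : Function.Involutive f := by
    intro u
    by_cases h : u ∈ B
    · rw [f1 u h, f2 _ (hto u h), Equiv.symm_apply_apply]
    · by_cases h' : u ∈ B'
      · rw [f2 u h', f1 _ (hfrom u h'), Equiv.apply_symm_apply]
      · rw [f3 u h h', f3 u h h']
  have hch : ∀ u v, Child G r u v → Child G r (f u) (f v) := by
    intro u v h
    by_cases hu : u ∈ B
    · have hv : v ∈ B := Relation.ReflTransGen.tail hu h
      rw [f1 u hu, f1 v hv]
      exact h.map hG.connected hφ
    by_cases hu' : u ∈ B'
    · have hv : v ∈ B' := Relation.ReflTransGen.tail hu' h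
      rw [f2 u hu', f2 v hv]
      exact h.map hG.connected (Subgroup.inv_mem _ hφ)
    have hc' : Child G r p (φ c) := by simpa [hp] using hc.map hG.connected hφ
    by_cases hv : v ∈ B
    · rcases Relation.ReflTransGen.cases_tail hv with h1 | ⟨x, h1, h2⟩
      · subst h1
        obtain rfl := h.unique hG hc
        rw [f3 _ hu hu', f1 _ hv]
        exact hc'
      · obtain rfl := h.unique hG h2
        exact absurd h1 hu
    by_cases hv' : v ∈ B'
    · rcases Relation.ReflTransGen.cases_tail hv' with h1 | ⟨x, h1, h2⟩
      · subst h1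
        obtain rfl := h.unique hG hc'
        rw [f3 _ hu hu', f2 _ hv', Equiv.symm_apply_apply]
        exact hc
      · obtain rfl := h.unique hG h2
        exact absurd h1 hu'
    rw [f3 u hu hu', f3 v hv hv']
    exact h
  have hadj : ∀ u v, G.Adj u v → G.Adj (f u) (f v) := by
    intro u v h
    rw [adj_iff_child hG (r := r)] at h ⊢
    exact h.imp (hch _ _) (hch _ _)
  let ψ : G ≃g G := ⟨hf.toPerm, fun {u v} => ⟨fun h => by
    have := hadj _ _ h
    simpa [Function.Involutive.coe_toPerm, hf u, hf v] using this, hadj u v⟩⟩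
  have hψ : ∀ u, ψ u = f u := fun _ => rfl
  have hψne : ψ ≠ SimpleGraph.Iso.refl := by
    intro h
    have h1 : ψ c = c := by rw [h]; rfl
    rw [hψ, f1 c Relation.ReflTransGen.refl] at h1
    exact hne h1
  have h1 : (m : WithTop Cardinal.{u}) ≤ ((#(moved ψ) : Cardinal.{u}) : WithTop Cardinal.{u}) :=
    hmotion.trans (iInf_le (fun φ : {φ : G ≃g G // φ ≠ SimpleGraph.Iso.refl} =>
      ((#(moved φ.1) : Cardinal.{u}) : WithTop Cardinal.{u})) ⟨ψ, hψne⟩)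
  have h2 : m ≤ #(moved ψ) := WithTop.coe_le_coe.1 h1
  have h3 : moved ψ ⊆ B ∪ B' := by
    intro u hu
    by_contra h
    rw [Set.mem_union, not_or] at h
    exact hu (f3 u h.1 h.2)
  have h4 : #B' ≤ #B :=
    mk_le_of_injective (f := fun u : B' => (⟨φ.symm u, hfrom u u.2⟩ : B)) fun a b h =>
      Subtype.ext (φ.symm.injective (congrArg Subtype.val h))
  -- The exchange moves only vertices of the two branches, which have equal size; as `m` is
  -- infinite, one of them already has `m` vertices.
  have h5 : m ≤ #B + #B := (h2.trans ((mk_le_mk_of_subset h3).trans (mk_union_le B B'))).trans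
    (add_le_add_right h4 _)
  have h6 : ℵ₀ ≤ #B := by
    by_contra h
    exact (hm.trans h5).not_gt (add_lt_aleph0 (not_le.1 h) (not_le.1 h))
  rwa [add_eq_self h6] at h5

/-! ### The trunk -/

/-- The vertices from which a ray leads away from the root. -/
def trunk (G : SimpleGraph V) (r : V) : Set V := {v | ¬ Acc (fun c p => Child G r p c) v}

/-- The oriented edge `e` can follow `e'` on a path. -/
def Onward (G : SimpleGraph V) (e e' : V × V) : Prop :=
  e.1 = e'.2 ∧ G.Adj e.1 e.2 ∧ e.2 ≠ e'.1

theorem exists_child_mem_trunk {r v : V} (hv : v ∈ trunk G r) : ∃ c, Child G r v c ∧ c ∈ trunk G r := by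
  by_contra h
  refine hv (Acc.intro _ fun c hc => ?_)
  by_contra hc'
  exact h ⟨c, hc, hc'⟩

theorem mem_trunk_of_child {r p c : V} (h : Child G r p c) (hc : c ∈ trunk G r) : p ∈ trunk G r :=
  fun hp => hc (hp.inv h)

theorem Child.asymm {r u v : V} (h : Child G r u v) : ¬ Child G r v u := fun h' => by
  have := h.2
  have := h'.2
  omega

/-- A non-backtracking continuation of an edge pointing away from the root keeps pointing away from
it. This replaces descent from `r` by a notion that does not mention the root. -/
theorem acc_onward_iff (hG : G.IsTree) {r p c : V} (h : Child G r p c) :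
    Acc (Onward G) (p, c) ↔ Acc (fun c p => Child G r p c) c := by
  constructor
  · intro ha
    generalize he : (p, c) = e at ha
    induction ha generalizing p c with
    | intro e _ ih =>
      subst he
      refine Acc.intro _ fun x hx => ih (c, x) ⟨rfl, hx.1, ?_⟩ hx rfl
      rintro rfl
      exact h.asymm hx
  · intro ha
    induction ha generalizing p with
    | intro c _ ih =>
      refine Acc.intro _ ?_
      rintro ⟨c', x⟩ ⟨h1, h2, h3⟩
      obtain rfl : c' = c := h1
      have hx : Child G r c' x := by
        refine ((adj_iff_child hG (r := r)).1 h2).resolve_right fun h4 => h3 ?_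
        exact h4.unique hG h
      exact ih x hx hx

/-- The right side says that `v` lies on a double ray, so the trunk does not depend on the root.
From a trunk vertex one ray leads down; another climbs to `r` and leaves through whichever of `c`,
`c'` was not on the way up. -/
theorem mem_trunk_iff (hG : G.IsTree) {r c c' : V} (hc : Child G r r c) (hc' : Child G r r c')
    (hne : c ≠ c') (h : c ∈ trunk G r) (h' : c' ∈ trunk G r) (v : V) :
    v ∈ trunk G r ↔ ∃ w w', w ≠ w' ∧ G.Adj v w ∧ G.Adj v w' ∧ ¬ Acc (Onward G) (v, w) ∧
      ¬ Acc (Onward G) (v, w') := by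
  constructor
  · intro hv
    by_cases hvr : v = r
    · subst hvr
      exact ⟨c, c', hne, hc.1, hc'.1, by rwa [acc_onward_iff hG hc], by rwa [acc_onward_iff hG hc']⟩
    have hup : ∀ x, Below G r r x → ∀ p, Child G r p x → ¬ Acc (Onward G) (x, p) := by
      intro x hx
      induction hx with
      | refl => intro p hp; have := hp.2; simp at this
      | @tail y x hy hyx ih =>
        intro p hp hacc
        obtain rfl := hp.unique hG hyx
        by_cases hpr : p = r
        · subst hpr
          obtain ⟨z, hz, hzx, hzt⟩ : ∃ z, Child G p p z ∧ z ≠ x ∧ z ∈ trunk G p := by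
            by_cases hcx : c = x
            · exact ⟨c', hc', by rw [← hcx]; exact hne.symm, h'⟩
            · exact ⟨c, hc, hcx, h⟩
          exact hzt ((acc_onward_iff hG hz).1 (hacc.inv ⟨rfl, hz.1, hzx⟩))
        · obtain ⟨q, hq⟩ := exists_child hG hpr
          refine ih q hq (hacc.inv ⟨rfl, hq.1.symm, ?_⟩)
          rintro rfl
          exact hq.asymm hp
    obtain ⟨w, hw, hwt⟩ := exists_child_mem_trunk hv
    obtain ⟨p, hp⟩ := exists_child hG hvr
    refine ⟨w, p, ?_, hw.1, hp.1.symm, by rwa [acc_onward_iff hG hw], hup v (desc_root hG r v) p hp⟩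
    rintro rfl
    exact hw.asymm hp
  · rintro ⟨w, w', hww, h1, h2, h3, h4⟩
    have key : ∀ x, Child G r v x → ¬ Acc (Onward G) (v, x) → v ∈ trunk G r := fun x hx hn =>
      mem_trunk_of_child hx (by rwa [acc_onward_iff hG hx] at hn)
    rcases (adj_iff_child hG (r := r)).1 h1 with h5 | h5
    · exact key w h5 h3
    · refine key w' (((adj_iff_child hG (r := r)).1 h2).resolve_right fun h6 => ?_) h4
      exact hww (h5.unique hG h6)

theorem acc_onward_map (ψ : G ≃g G) {e : V × V} (h : Acc (Onward G) e) :
    Acc (Onward G) (ψ e.1, ψ e.2) := by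
  induction h with
  | intro e _ ih =>
    refine Acc.intro _ ?_
    rintro ⟨x, y⟩ ⟨h1, h2, h3⟩
    have := ih (ψ.symm x, ψ.symm y) ⟨?_, ?_, ?_⟩
    · simpa using this
    · simp only at h1
      simp [h1]
    · exact ψ.symm.map_adj_iff.2 h2
    · intro h4
      apply h3
      simp only at h4
      simp [← h4]

theorem trunk_map (hG : G.IsTree) {r c c' : V} (hc : Child G r r c) (hc' : Child G r r c')
    (hne : c ≠ c') (h : c ∈ trunk G r) (h' : c' ∈ trunk G r) (ψ : G ≃g G) {v : V}
    (hv : v ∈ trunk G r) : ψ v ∈ trunk G r := by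
  rw [mem_trunk_iff hG hc hc' hne h h'] at hv ⊢
  obtain ⟨w, w', h1, h2, h3, h4, h5⟩ := hv
  refine ⟨ψ w, ψ w', fun h6 => h1 (ψ.injective h6), ψ.map_adj_iff.2 h2, ψ.map_adj_iff.2 h3,
    fun h6 => h4 ?_, fun h6 => h5 ?_⟩
  · simpa using acc_onward_map ψ.symm h6
  · simpa using acc_onward_map ψ.symm h6

theorem mem_trunk_of_ray (hG : G.IsTree) {f : ℕ → V} (hf : Function.Injective f)
    (hadj : ∀ n, G.Adj (f n) (f (n + 1))) (n : ℕ) :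
    Child G (f 0) (f n) (f (n + 1)) ∧ f n ∈ trunk G (f 0) := by
  have hch : ∀ n, Child G (f 0) (f n) (f (n + 1)) := by
    intro n
    refine ((adj_iff_child hG (r := f 0)).1 (hadj n)).resolve_right fun h => ?_
    induction n with
    | zero => have := h.2; simp at this
    | succ n ih =>
      have h1 : Child G (f 0) (f n) (f (n + 1)) :=
        ((adj_iff_child hG (r := f 0)).1 (hadj n)).resolve_right ih
      have := hf (h.unique hG h1)
      omega
  refine ⟨hch n, fun hacc => ?_⟩
  generalize hx : f n = x at hacc
  induction hacc generalizing n with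
  | intro x _ ih =>
    subst hx
    exact ih _ (hch n) (n + 1) rfl

theorem exists_root (hG : G.IsTree) (h : HasDoubleRay G) : ∃ r c c', Child G r r c ∧ Child G r r c' ∧
    c ≠ c' ∧ c ∈ trunk G r ∧ c' ∈ trunk G r := by
  obtain ⟨ρ, hρ, hadj⟩ := h
  have h1 := mem_trunk_of_ray hG (f := fun n : ℕ => ρ n)
    (fun a b hab => by simpa using hρ hab) (fun n => by simpa using hadj n)
  have h2 := mem_trunk_of_ray hG (f := fun n : ℕ => ρ (-n))
    (fun a b hab => by simpa using hρ hab) (fun n => by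
      have := (hadj (-(n + 1 : ℕ))).symm
      have h3 : -((n + 1 : ℕ) : ℤ) + 1 = -n := by push_cast; ring
      rwa [h3] at this)
  refine ⟨ρ 0, ρ 1, ρ (-1), by simpa using (h1 0).1, by simpa using (h2 0).1, fun h => ?_,
    by simpa using (h1 1).2, by simpa using (h2 1).2⟩
  have := hρ h
  omega

namespace Forest

variable {α : Type u}

/-- The union of the sets `X u`, over the descendants `u` of `v` lying `n` levels below `v`. -/
def levelUnion (F : Forest V α) (X : V → Set V) : ℕ → V → Set V
  | 0, v => X v
  | n + 1, v => ⋃ c : {c // F.ch v c}, F.levelUnion X n c.1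

theorem mk_levelUnion_le {F : Forest V α} {X : V → Set V} {w : V → Cardinal.{u}}
    (h : ∀ v, #(X v) ≤ w v) (n : ℕ) (v : V) : #(F.levelUnion X n v) ≤ F.levelWeight w n v := by
  induction n generalizing v with
  | zero => exact h v
  | succ n ih =>
    exact mk_iUnion_le_sum_mk.trans (sum_le_sum _ _ fun c => ih c.1)

theorem exists_mem_of_reach {F : Forest V α} {k : V → Prop × α} {v u c : V}
    (h : F.Reach k v c) (hu : F.Desc v u) (hc : F.ch u c) : (k c).1 := by
  cases h with
  | refl => exact absurd rfl (ne_of_desc_of_ch hu hc)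
  | step _ _ h => exact h

end Forest

/-! ### Branches hanging off the trunk, and rigid colourings of the trunk -/

open Forest

/-- The isomorphism given by a member of `rootedAut`. -/
def isoOfRootedAut {r : V} {φ : Equiv.Perm V} (hφ : φ ∈ rootedAut G r) : G ≃g G :=
  ⟨φ, fun {a b} => hφ.2 a b⟩

/-- The forest of the branches of `G` hanging off the trunk. Vertices off the trunk have two
colours, vertices on the trunk only one. -/
noncomputable def hang (hG : G.IsTree) (r : V)
    (hinv : ∀ φ ∈ rootedAut G r, ∀ v, φ v ∈ trunk G r ↔ v ∈ trunk G r) :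
    Forest V (ULift.{u} Prop) :=
  graphForest hG r (trunk G r)ᶜ (fun φ hφ v h h' => h ((hinv φ hφ v).1 h'))
    (fun v => {x | v ∈ trunk G r → x.down}) (fun _ => ⟨⟨True⟩, fun _ => trivial⟩)
    (fun φ hφ v => by simp only [hinv φ hφ v])

section hang

variable {hG : G.IsTree} {r : V}
  {hinv : ∀ φ ∈ rootedAut G r, ∀ v, φ v ∈ trunk G r ↔ v ∈ trunk G r}

/-- The vertices off the trunk that hang off `v`. -/
def hangSet (hG : G.IsTree) (r : V)
    (hinv : ∀ φ ∈ rootedAut G r, ∀ v, φ v ∈ trunk G r ↔ v ∈ trunk G r) (v : V) : Set V :=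
  {u | (hang hG r hinv).Desc v u ∧ u ∉ trunk G r}

theorem hang_desc_of_below {v u : V} (hv : v ∉ trunk G r) (h : Below G r v u) :
    (hang hG r hinv).Desc v u ∧ u ∉ trunk G r := by
  induction h with
  | refl => exact ⟨.refl, hv⟩
  | tail _ h ih =>
    have h1 := fun h2 => ih.2 (mem_trunk_of_child h h2)
    exact ⟨ih.1.tail ⟨h, h1⟩, h1⟩

theorem mk_NF_le {α : Type u} {D : Set V} {hD : ∀ φ ∈ rootedAut G r, ∀ v, v ∈ D → φ v ∈ D}
    {C : V → Set α} {hne : ∀ v, (C v).Nonempty} {hC : ∀ φ ∈ rootedAut G r, ∀ v, C (φ v) = C v}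
    {κ : Cardinal.{u}} (hdeg : ∀ p, #{c | Child G r p c} ≤ κ) (p : V) :
    #((graphForest hG r D hD C hne hC).NF p) ≤ κ :=
  (mk_le_mk_of_subset (fun _ hc => hc.1.1)).trans (hdeg p)

/-- By recursion on rayless branches: a movable child has a branch of size at least `m`, so
inductively at least `2 ^ m` types, which is enough to separate its siblings, and `prod_le_mk_T`
applies. -/
theorem two_power_hangSet_le {m : Cardinal.{u}} (hm : ℵ₀ ≤ m)
    (hmotion : (m : WithTop Cardinal.{u}) ≤ motion G) (hdeg : ∀ p, #{c | Child G r p c} ≤ 2 ^ m)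
    (v : V) : 2 ^ #(hangSet hG r hinv v) ≤ #((hang hG r hinv).T True v) := by
  set F := hang hG r hinv with hF
  have step : ∀ v, (∀ c, F.ch v c → 2 ^ #(hangSet hG r hinv c) ≤ #(F.T True c)) →
      2 ^ #(hangSet hG r hinv v) ≤ #(F.T True v) := by
    intro v ih
    have hNF : ∀ c ∈ F.NF v, ℵ₀ ≤ #(F.T True c) ∧ #(F.NF v) ≤ #(F.T True c) := by
      rintro c ⟨hc, φ, hφ, hv, hne⟩
      have h1 : m ≤ #(hangSet hG r hinv c) :=
        (le_mk_below hG hm hmotion hc.1 hφ hv hne).trans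
          (mk_le_mk_of_subset fun u hu => hang_desc_of_below hc.2 hu)
      have h2 : 2 ^ m ≤ #(F.T True c) :=
        (power_le_power_left two_ne_zero h1).trans (ih c hc)
      exact ⟨(hm.trans (cantor m).le).trans h2, (mk_NF_le hdeg v).trans h2⟩
    have hsub : hangSet hG r hinv v ⊆
        ({v} \ trunk G r) ∪ ⋃ c : {c // F.ch v c}, hangSet hG r hinv c.1 := by
      rintro u ⟨hu, hut⟩
      rcases Relation.ReflTransGen.cases_head hu with rfl | ⟨c, hc, hcu⟩
      · exact Or.inl ⟨rfl, hut⟩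
      · exact Or.inr (Set.mem_iUnion.2 ⟨⟨c, hc⟩, hcu, hut⟩)
    have h1 : #(hangSet hG r hinv v) ≤ #({v} \ trunk G r : Set V) +
        Cardinal.sum fun c : {c // F.ch v c} => #(hangSet hG r hinv c.1) :=
      ((mk_le_mk_of_subset hsub).trans (mk_union_le _ _)).trans
        (add_le_add le_rfl mk_iUnion_le_sum_mk)
    have h2 : (2 : Cardinal.{u}) ^ #({v} \ trunk G r : Set V) ≤ #(F.C v) := by
      by_cases hv : v ∈ trunk G r
      · have : ({v} \ trunk G r : Set V) = ∅ := by
          rw [Set.sdiff_eq_empty]; simpa using hv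
        rw [this, mk_eq_zero, power_zero, Cardinal.one_le_iff_ne_zero, mk_ne_zero_iff]
        exact (F.nonempty_C v).to_subtype
      · have h3 : F.C v = Set.univ := Set.eq_univ_of_forall fun x h => absurd h hv
        have h4 : #({v} \ trunk G r : Set V) ≤ 1 :=
          (mk_le_mk_of_subset Set.sdiff_subset).trans (mk_singleton v).le
        rw [h3, mk_univ]
        refine (power_le_power_left two_ne_zero h4).trans ?_
        simp
    refine (power_le_power_left two_ne_zero h1).trans ?_
    rw [power_add, power_sum]
    refine (mul_le_mul' h2 (prod_le_prod _ _ fun c : {c // F.ch v c} => ih c.1 c.2)).trans ?_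
    exact prod_le_mk_T hNF
  -- The vertex `v` may lie on the trunk, but its children in this forest do not, so the induction
  -- can start from them.
  refine step v fun c hc => ?_
  have hacc : Acc (fun c p => Child G r p c) c := not_not.1 hc.2
  clear hc
  induction hacc with
  | intro c _ ih => exact step c fun x hx => ih x hx.1

theorem exists_trunk_desc (hr : r ∈ trunk G r) (x : V) :
    ∃ v ∈ trunk G r, (hang hG r hinv).Desc v x := by
  have := desc_root hG r x
  induction this with
  | refl => exact ⟨r, hr, .refl⟩
  | @tail p c _ hc ih =>
    by_cases h : c ∈ trunk G r
    · exact ⟨c, h, .refl⟩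
    · obtain ⟨v, hv, hd⟩ := ih
      exact ⟨v, hv, hd.tail ⟨hc, h⟩⟩

theorem trunk_desc_unique {v v' x : V} (hv : v ∈ trunk G r) (hv' : v' ∈ trunk G r)
    (h : (hang hG r hinv).Desc v x) (h' : (hang hG r hinv).Desc v' x) : v = v' := by
  induction h with
  | refl =>
    rcases Relation.ReflTransGen.cases_tail h' with h1 | ⟨_, _, h2⟩
    · exact h1
    · exact absurd hv h2.2
  | tail _ h2 ih =>
    rcases Relation.ReflTransGen.cases_tail h' with h3 | ⟨_, h3, h4⟩
    · exact absurd (h3 ▸ hv') h2.2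
    · obtain rfl := h2.1.unique hG h4.1
      exact ih h3

theorem eq_or_not_mem_trunk {v u : V} (h : (hang hG r hinv).Desc v u) :
    u = v ∨ u ∉ trunk G r := by
  rcases Relation.ReflTransGen.cases_tail h with h1 | ⟨_, _, h2⟩
  · exact Or.inl h1
  · exact Or.inr h2.2

theorem mk_hang_desc_le (v : V) :
    #{u | (hang hG r hinv).Desc v u} ≤ ℵ₀ + #(hangSet hG r hinv v) := by
  have : {u | (hang hG r hinv).Desc v u} ⊆ {v} ∪ hangSet hG r hinv v := fun u hu =>
    (eq_or_not_mem_trunk hu).imp id fun h => ⟨hu, h⟩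
  refine ((mk_le_mk_of_subset this).trans (mk_union_le _ _)).trans (add_le_add ?_ le_rfl)
  rw [mk_singleton]
  exact one_le_aleph0

variable (hG r hinv) in
/-- The colours available for coding at the vertices of the trunk: a type of labels for the
branches hanging off this vertex, together with a sequence of bits. -/
abbrev TrunkColor := (hang hG r hinv).LabelType × (ℕ → Prop)

theorem hangSet_map {φ : Equiv.Perm V} (hφ : φ ∈ rootedAut G r) (v : V) :
    #(hangSet hG r hinv (φ v)) = #(hangSet hG r hinv v) := by
  have key : ∀ {φ : Equiv.Perm V}, φ ∈ rootedAut G r → ∀ v,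
      #(hangSet hG r hinv v) ≤ #(hangSet hG r hinv (φ v)) := fun {φ} hφ v =>
    mk_le_of_injective (f := fun u : hangSet hG r hinv v => (⟨φ u,
      Desc.map (F := hang hG r hinv) hφ u.2.1, fun h => u.2.2 ((hinv φ hφ _).1 h)⟩ :
        hangSet hG r hinv (φ v))) fun a b h =>
      Subtype.ext (φ.injective (congrArg Subtype.val h))
  refine le_antisymm ?_ (key hφ v)
  simpa using key (Subgroup.inv_mem _ hφ) (φ v)

theorem trunk_desc_root {α : Type u} {hD : ∀ φ ∈ rootedAut G r, ∀ v, v ∈ trunk G r → φ v ∈ trunk G r}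
    {C : V → Set α} {hne : ∀ v, (C v).Nonempty} {hC : ∀ φ ∈ rootedAut G r, ∀ v, C (φ v) = C v}
    {v : V} (hv : v ∈ trunk G r) : (graphForest hG r (trunk G r) hD C hne hC).Desc r v := by
  have := desc_root hG r v
  induction this with
  | refl => exact .refl
  | tail _ h ih => exact (ih (mem_trunk_of_child h hv)).tail ⟨h, hv⟩

/-- The trunk forest is coloured with elements of `E v`. Their number is cut down to exactly `2 ^
(ℵ₀ + |hangSet|)`, so that countable sequences of colours can later be coded by a single one. -/
theorem exists_rigid_trunk_coloring {m : Cardinal.{u}} (hm : ℵ₀ ≤ m)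
    (hmotion : (m : WithTop Cardinal.{u}) ≤ motion G) (hdeg : ∀ p, #{c | Child G r p c} ≤ 2 ^ m) :
    ∃ (E : V → Set (TrunkColor hG r hinv)) (f : ℕ → V → Prop × TrunkColor hG r hinv),
      (∀ v, ∀ x ∈ E v, x.1 ∈ (hang hG r hinv).T True v) ∧
      (∀ v, #(E v) = 2 ^ (ℵ₀ + #(hangSet hG r hinv v))) ∧
      (∀ φ ∈ rootedAut G r, ∀ v, E (φ v) = E v) ∧ (∀ n v, (f n v).2 ∈ E v) ∧
      ∀ φ ∈ rootedAut G r, (∀ n, ∀ v ∈ trunk G r, f n (φ v) = f n v) → ∀ v ∈ trunk G r, φ v = v := by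
  -- Selecting as a function of the set and the cardinal alone makes `E` invariant under the
  -- automorphisms fixing `r`.
  have hsel : ∀ (S : Set (TrunkColor hG r hinv)) (κ : Cardinal.{u}),
      ∃ E : Set (TrunkColor hG r hinv), κ ≤ #S → E ⊆ S ∧ #E = κ := by
    intro S κ
    by_cases h : κ ≤ #S
    · obtain ⟨E, hE⟩ := le_mk_iff_exists_subset.1 h
      exact ⟨E, fun _ => hE⟩
    · exact ⟨∅, fun h' => absurd h' h⟩
  choose sel hsel using hsel
  set H := hang hG r hinv with hH
  set w : V → Cardinal.{u} := fun v => ℵ₀ + #(hangSet hG r hinv v) with hw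
  have hw0 : ∀ v, ℵ₀ ≤ w v := fun v => self_le_add_right _ _
  let S : V → Set (TrunkColor hG r hinv) := fun v => {x | x.1 ∈ H.T True v}
  let E : V → Set (TrunkColor hG r hinv) := fun v => sel (S v) (2 ^ w v)
  have hS : ∀ v, 2 ^ w v ≤ #(S v) := by
    intro v
    have h1 : #(H.T True v × (ℕ → Prop)) ≤ #(S v) :=
      mk_le_of_injective (f := fun x : H.T True v × (ℕ → Prop) => (⟨(x.1, x.2), x.1.2⟩ : S v))
        fun a b h => by
          have := congrArg Subtype.val h
          simp only [Prod.mk.injEq] at this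
          exact Prod.ext (Subtype.ext this.1) this.2
    refine le_trans ?_ h1
    rw [hw, power_add, mul_comm]
    have h2 := two_power_hangSet_le (hG := hG) (hinv := hinv) hm hmotion hdeg v
    simpa using mul_le_mul' h2 (le_refl ((2 : Cardinal.{u}) ^ ℵ₀))
  have hE : ∀ v, E v ⊆ S v ∧ #(E v) = 2 ^ w v := fun v => hsel _ _ (hS v)
  have hne : ∀ v, (E v).Nonempty := by
    intro v
    rw [← Set.nonempty_coe_sort, ← mk_ne_zero_iff, (hE v).2]
    exact (power_pos _ two_pos).ne'
  have hmap : ∀ φ ∈ rootedAut G r, ∀ v, E (φ v) = E v := by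
    intro φ hφ v
    have h1 : H.T True (φ v) = H.T True v := T_map (F := H) hφ v
    simp only [E, S, hw, h1, hangSet_map hφ]
  let F := graphForest hG r (trunk G r) (fun φ hφ v h => (hinv φ hφ v).2 h) E hne hmap
  have hlarge : ∀ c : V, m ≤ #{u | Below G r c u} → 2 ^ m ≤ #(ℕ → F.T False c) := by
    intro c hc
    refine two_power_le_mk_seq (F := F) (w := w) hw0 (fun v => (hE v).2.ge)
      (large := fun v => m ≤ #{u | Below G r v u}) ?_ ?_ ?_ hc
    · intro p c hpc h
      exact h.trans (mk_le_mk_of_subset fun u hu => Relation.ReflTransGen.head hpc.1 hu)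
    · rintro p c ⟨hc, φ, hφ, hp, hne⟩
      exact le_mk_below hG hm hmotion hc.1 hφ hp hne
    · intro v hv
      -- A descending path follows the trunk for `n` steps and then stays off it; weighting a trunk
      -- vertex by what hangs off it therefore counts the whole branch.
      have hcover : ∀ v u, Below G r v u → ∃ n, u ∈ F.levelUnion (fun v => {u | H.Desc v u}) n v := by
        intro v u h
        induction h using Relation.ReflTransGen.head_induction_on with
        | refl => exact ⟨0, Relation.ReflTransGen.refl⟩
        | @head v c hc hcu ih =>
          by_cases hct : c ∈ trunk G r
          · obtain ⟨n, hn⟩ := ih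
            exact ⟨n + 1, Set.mem_iUnion.2 ⟨⟨c, hc, hct⟩, hn⟩⟩
          · exact ⟨0, Relation.ReflTransGen.head ⟨hc, hct⟩ (hang_desc_of_below hct hcu).1⟩
      have hsub : {u | Below G r v u} ⊆ ⋃ n, F.levelUnion (fun v => {u | H.Desc v u}) n v :=
        fun u hu => Set.mem_iUnion.2 (hcover v u hu)
      refine (hv.trans (mk_le_mk_of_subset hsub)).trans ?_
      have h1 := mk_iUnion_le_sum_mk_lift (f := fun n => F.levelUnion (fun v => {u | H.Desc v u}) n v)
      rw [lift_uzero] at h1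
      exact h1.trans (sum_le_sum _ _ fun n => mk_levelUnion_le (fun v => mk_hang_desc_le v) n v)
  obtain ⟨f, hf1, hf2⟩ := exists_rigid_coloring (F := F) (r := r) (fun φ hφ => hφ.1) <| by
    rintro p c ⟨hc, φ, hφ, hp, hne⟩
    exact (mk_NF_le hdeg p).trans (hlarge c (le_mk_below hG hm hmotion hc.1 hφ hp hne))
  refine ⟨E, f, fun v x hx => (hE v).1 hx, fun v => (hE v).2, hmap, hf1, fun φ hφ h v hv => ?_⟩
  refine hf2 φ hφ (fun n v hv => ?_) v (trunk_desc_root hv)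
  by_cases hvr : v = r
  · rw [hvr, hφ.1]
  · rcases Relation.ReflTransGen.cases_tail hv with h1 | ⟨_, _, h2⟩
    · exact absurd h1 hvr
    · exact h n v h2.2

end hang

/-! ### Coding a trunk colouring by a set of vertices -/

variable {hG : G.IsTree} {r : V}
  {hinv : ∀ φ ∈ rootedAut G r, ∀ v, φ v ∈ trunk G r ↔ v ∈ trunk G r}

open Classical in
/-- The vertex of the trunk off which `x` hangs. -/
noncomputable def base (hG : G.IsTree) (r : V)
    (hinv : ∀ φ ∈ rootedAut G r, ∀ v, φ v ∈ trunk G r ↔ v ∈ trunk G r) (x : V) : V :=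
  if h : ∃ v ∈ trunk G r, (hang hG r hinv).Desc v x then h.choose else r

theorem base_eq {v x : V} (hv : v ∈ trunk G r) (h : (hang hG r hinv).Desc v x) :
    base hG r hinv x = v := by
  have h' : ∃ v ∈ trunk G r, (hang hG r hinv).Desc v x := ⟨v, hv, h⟩
  rw [base, dif_pos h']
  exact trunk_desc_unique h'.choose_spec.1 hv h'.choose_spec.2 h

/-- The label of the branches hanging off `v` encoded by the colour of `v`. -/
noncomputable def hangLabel (g : V → TrunkColor hG r hinv) (v : V) : V → Prop × ULift.{u} Prop :=
  (hang hG r hinv).lab True v (g v).1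

/-- The set of vertices encoding the colouring `g` of the trunk. The vertices of the trunk in this
set at distance at most one from the root serve to recognise the root; those further down store
the bits of the colours of their ancestors. -/
def paint (g : V → TrunkColor hG r hinv) : Set V :=
  -- The level of a storing vertex names both the level `n` of the ancestor and the bit `j`. Bits
  -- occupy only even levels from 4 on, leaving level 2 and all odd levels above 1 unpainted on the
  -- trunk, which makes the root recognisable.
  {x | (x ∈ trunk G r ∧ (G.dist r x = 0 ∨ G.dist r x = 1 ∨ ∃ n j : ℕ,
      G.dist r x = 2 * Nat.pair n j + 4 ∧ (g ((parent G r)^[G.dist r x - n] x)).2 j)) ∨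
    (x ∉ trunk G r ∧ (hangLabel g (base hG r hinv x) x).2.down)}

theorem exists_trunk_below {v : V} (hv : v ∈ trunk G r) (k : ℕ) :
    ∃ x ∈ trunk G r, Below G r v x ∧ G.dist r x = G.dist r v + k := by
  induction k with
  | zero => exact ⟨v, hv, .refl, rfl⟩
  | succ k ih =>
    obtain ⟨x, hx, h1, h2⟩ := ih
    obtain ⟨c, hc, hct⟩ := exists_child_mem_trunk hx
    exact ⟨c, hct, h1.tail hc, by rw [hc.2, h2]; rfl⟩

theorem iterate_parent_of_below (hG : G.IsTree) {v u : V} (h : Below G r v u) :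
    (parent G r)^[G.dist r u - G.dist r v] u = v := by
  induction h with
  | refl => simp
  | tail h1 h ih =>
    have h2 := Below.dist_le h1
    rw [h.2, Nat.succ_sub h2, Function.iterate_succ_apply, parent_eq hG h, ih]

theorem mem_paint_bit {g : V → TrunkColor hG r hinv} {v x : V} (hx : x ∈ trunk G r)
    (h : Below G r v x) {j : ℕ} (hd : G.dist r x = 2 * Nat.pair (G.dist r v) j + 4) :
    x ∈ paint g ↔ (g v).2 j := by
  have h1 := iterate_parent_of_below hG h
  constructor
  · rintro (⟨-, h2 | h2 | ⟨n, j', h2, h3⟩⟩ | ⟨h2, -⟩)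
    · omega
    · omega
    · have h4 : Nat.pair (G.dist r v) j = Nat.pair n j' := by omega
      obtain ⟨rfl, rfl⟩ := Nat.pair_eq_pair.1 h4
      rwa [h1] at h3
    · exact absurd hx h2
  · intro h2
    exact Or.inl ⟨hx, Or.inr (Or.inr ⟨_, j, hd, by rwa [h1]⟩)⟩

theorem mem_paint_hang {g : V → TrunkColor hG r hinv} {v x : V} (hv : v ∈ trunk G r)
    (h : (hang hG r hinv).Desc v x) (hx : x ∉ trunk G r) :
    x ∈ paint g ↔ (hangLabel g v x).2.down := by
  simp [paint, hx, base_eq hv h]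

theorem adm_hangLabel {g : V → TrunkColor hG r hinv} {v : V}
    (hg : (g v).1 ∈ (hang hG r hinv).T True v) :
    (hang hG r hinv).Adm True v (hangLabel g v) := adm_lab hg

section decode

variable {g g' : V → TrunkColor hG r hinv} {φ : Equiv.Perm V}

/-- Full labels mark every descendant, so only the colours need comparing: off the trunk the painted
set shows them, on the trunk only one is allowed. -/
theorem match_hangLabel (hg : ∀ v, (g v).1 ∈ (hang hG r hinv).T True v)
    (hg' : ∀ v, (g' v).1 ∈ (hang hG r hinv).T True v) (hφ : φ ∈ rootedAut G r)
    (h : ∀ x, x ∈ paint g ↔ φ x ∈ paint g') {v : V} (hv : v ∈ trunk G r) :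
    (hang hG r hinv).Match φ (hangLabel g v) (hangLabel g' (φ v)) v := by
  set H := hang hG r hinv
  have hA := adm_hangLabel (hg v)
  have hA' := adm_hangLabel (hg' (φ v))
  intro u hu
  have hd : H.Desc (φ v) (φ u) := Desc.map (F := H) hφ hu.desc
  constructor
  · by_cases hut : u ∈ trunk G r
    · have h1 := hA.col u hut
      have h2 := hA'.col (φ u) ((hinv φ hφ u).2 hut)
      exact ULift.ext _ _ (propext ⟨fun _ => h2, fun _ => h1⟩)
    · refine ULift.ext _ _ (propext ?_)
      rw [← mem_paint_hang hv hu.desc hut, h u, mem_paint_hang ((hinv φ hφ v).2 hv) hd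
        fun h' => hut ((hinv φ hφ u).1 h')]
  · intro c hc
    have hc' : H.ch (φ u) (φ c) := H.map_ch hφ hc
    exact iff_of_true (exists_mem_of_reach (hA.reach trivial c (hu.desc.tail hc)) hu.desc hc)
      (exists_mem_of_reach (hA'.reach trivial _ (hd.tail hc')) hd hc')

theorem color_eq_of_paint (hg : ∀ v, (g v).1 ∈ (hang hG r hinv).T True v)
    (hg' : ∀ v, (g' v).1 ∈ (hang hG r hinv).T True v) (hφ : φ ∈ rootedAut G r)
    (h : ∀ x, x ∈ paint g ↔ φ x ∈ paint g') {v : V} (hv : v ∈ trunk G r) : g' (φ v) = g v := by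
  refine Prod.ext ?_ (funext fun j => propext ?_)
  · rw [← typ_lab (hg v), ← typ_lab (hg' (φ v))]
    exact (typ_eq.2 ⟨φ, hφ, rfl, match_hangLabel hg hg' hφ h hv⟩).symm
  -- Since `n ≤ Nat.pair n j`, the storing level lies below `v`, and the trunk below `v` reaches it.
  -- The vertex `x` and its image store the same bit position.
  · have hle := Nat.left_le_pair (G.dist r v) j
    obtain ⟨x, hx, h1, h2⟩ := exists_trunk_below hv
      (2 * Nat.pair (G.dist r v) j + 4 - G.dist r v)
    have h3 : G.dist r x = 2 * Nat.pair (G.dist r v) j + 4 := by omega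
    have hdv := dist_rootedAut hG.connected hφ v
    have hdx := dist_rootedAut hG.connected hφ x
    rw [← mem_paint_bit hx h1 h3, h x, mem_paint_bit ((hinv φ hφ x).2 hx)
      (Below.map hG.connected hφ h1) (by rw [hdx, hdv, h3])]

theorem apply_eq_of_paint (hg : ∀ v, (g v).1 ∈ (hang hG r hinv).T True v)
    (hg' : ∀ v, (g' v).1 ∈ (hang hG r hinv).T True v) (hφ : φ ∈ rootedAut G r)
    (h : ∀ x, x ∈ paint g ↔ φ x ∈ paint g') (hfix : ∀ v ∈ trunk G r, φ v = v)
    (hr : r ∈ trunk G r) (x : V) : φ x = x := by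
  obtain ⟨v, hv, hvx⟩ := exists_trunk_desc (hG := hG) (hinv := hinv) hr x
  have h1 := match_hangLabel hg hg' hφ h hv
  have h2 : hangLabel g' (φ v) = hangLabel g v := by
    have := color_eq_of_paint hg hg' hφ h hv
    rw [hfix v hv] at this ⊢
    rw [hangLabel, hangLabel, this]
  rw [h2] at h1
  have hA := adm_hangLabel (hg v)
  exact hA.rigid φ hφ (hfix v hv) h1 x (hA.reach trivial x hvx)

end decode

theorem dist_eq_of_mem_paint {g : V → TrunkColor hG r hinv} {x : V} (hx : x ∈ trunk G r)
    (h : x ∈ paint g) : G.dist r x = 1 ∨ (G.dist r x ≠ 2 ∧ G.dist r x % 2 = 0) := by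
  rcases h with ⟨-, h | h | ⟨n, j, h, -⟩⟩ | ⟨h, -⟩
  · right; omega
  · exact Or.inl h
  · right; omega
  · exact absurd hx h

/-- Away from the root, a painted trunk vertex has no painted trunk child, because no two
consecutive levels beyond 0 and 1 are painted; its parent is then its only possible painted trunk
neighbour. -/
theorem root_unique {g : V → TrunkColor hG r hinv} {v w w' : V} (hv : v ∈ trunk G r ∩ paint g)
    (hw : w ∈ trunk G r ∩ paint g) (hw' : w' ∈ trunk G r ∩ paint g) (h : G.Adj v w)
    (h' : G.Adj v w') (hne : w ≠ w') : v = r := by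
  by_contra hvr
  have h1 := dist_eq_of_mem_paint hv.1 hv.2
  have h0 : G.dist r v ≠ 0 := by
    rw [Ne, hG.connected.dist_eq_zero_iff]
    exact fun h => hvr h.symm
  have key : ∀ x, x ∈ trunk G r ∩ paint g → G.Adj v x → Child G r x v := by
    intro x hx hadj
    rcases (adj_iff_child hG (r := r)).1 hadj with h2 | h2
    · have h3 := dist_eq_of_mem_paint hx.1 hx.2
      have := h2.2
      omega
    · exact h2
  exact hne ((key w hw h).unique hG (key w' hw' h'))

theorem apply_root_eq {g g' : V → TrunkColor hG r hinv} {c c' : V} (hc : Child G r r c)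
    (hc' : Child G r r c') (hne : c ≠ c') (h : c ∈ trunk G r) (h' : c' ∈ trunk G r) (ψ : G ≃g G)
    (hψ : ∀ x, x ∈ paint g ↔ ψ x ∈ paint g') : ψ r = r := by
  have hmem : ∀ x, x ∈ trunk G r → G.dist r x ≤ 1 → ψ x ∈ trunk G r ∩ paint g' := by
    intro x hx hd
    refine ⟨trunk_map hG hc hc' hne h h' ψ hx, (hψ x).1 (Or.inl ⟨hx, ?_⟩)⟩
    omega
  have h1 := hc.2
  have h2 := hc'.2
  rw [SimpleGraph.dist_self] at h1 h2
  exact root_unique (hmem r (mem_trunk_of_child hc h) (by simp)) (hmem c h h1.le)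
    (hmem c' h' h2.le) (ψ.map_adj_iff.2 hc.1) (ψ.map_adj_iff.2 hc'.1) (ψ.injective.ne hne)

/-! ### Counting inequivalent asymmetrizing sets -/

theorem mk_encoding {κ : Cardinal.{u}} (hκ : ℵ₀ ≤ κ) {E : Type u} (hE : #E = 2 ^ κ) :
    #((ℕ → Prop × E) × E) = #E := by
  have h1 : (2 : Cardinal.{u}) * 2 ^ κ = 2 ^ κ := by
    rw [mul_comm]
    exact mul_eq_left (hκ.trans (cantor κ).le) ((natCast_lt_aleph0 (n := 2)).le.trans
      (hκ.trans (cantor κ).le)) two_ne_zero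
  have h2 : #(ℕ → Prop × E) = 2 ^ κ := by
    rw [mk_arrow, mk_prod, hE]
    simp [h1, ← power_mul, hκ]
  rw [mk_prod, lift_id, lift_id, h2, hE, ← power_add, add_eq_self hκ]

theorem exists_encoding {Γ : Type u} (E : Set Γ) {κ : Cardinal.{u}} (hκ : ℵ₀ ≤ κ)
    (hE : #E = 2 ^ κ) : ∃ e : (ℕ → Prop × Γ) → Γ → Γ,
      (∀ a t, (∀ n, (a n).2 ∈ E) → t ∈ E → e a t ∈ E) ∧
      ∀ a t a' t', (∀ n, (a n).2 ∈ E) → t ∈ E → (∀ n, (a' n).2 ∈ E) → t' ∈ E →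
        e a t = e a' t' → a = a' ∧ t = t' := by
  classical
  obtain ⟨e⟩ := (mk_encoding hκ hE).le
  refine ⟨fun a t => if h : (∀ n, (a n).2 ∈ E) ∧ t ∈ E then
    e (fun n => ((a n).1, ⟨(a n).2, h.1 n⟩), ⟨t, h.2⟩) else t, ?_, ?_⟩
  · intro a t h1 h2
    simp only [dif_pos (And.intro h1 h2)]
    exact (e _).2
  · intro a t a' t' h1 h2 h1' h2' h
    simp only [dif_pos (And.intro h1 h2), dif_pos (And.intro h1' h2')] at h
    have h3 := e.injective (Subtype.ext h)
    rw [Prod.mk.injEq] at h3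
    refine ⟨funext fun n => ?_, congrArg Subtype.val h3.2⟩
    have h4 := congrFun h3.1 n
    simp only [Prod.mk.injEq, Subtype.mk.injEq] at h4
    exact Prod.ext h4.1 h4.2

theorem asymNumber_le (G : SimpleGraph V) : asymNumber G ≤ 2 ^ #V := by
  refine mk_quotient_le.trans ?_
  rw [← mk_set]
  exact mk_subtype_le _

theorem two_power_le_asymNumber (hG : G.IsTree) {m : Cardinal.{u}} (hm : ℵ₀ ≤ m)
    (hmotion : (m : WithTop Cardinal.{u}) ≤ motion G) (hdeg : maxDeg G ≤ 2 ^ m)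
    (hray : HasDoubleRay G) : 2 ^ #V ≤ asymNumber G := by
  obtain ⟨r, c, c', hc, hc', hne, hct, hct'⟩ := exists_root hG hray
  have hr : r ∈ trunk G r := mem_trunk_of_child hc hct
  have hinv : ∀ φ ∈ rootedAut G r, ∀ v, φ v ∈ trunk G r ↔ v ∈ trunk G r := by
    intro φ hφ v
    refine ⟨fun h => ?_, fun h => trunk_map hG hc hc' hne hct hct' (isoOfRootedAut hφ) h⟩
    have := trunk_map hG hc hc' hne hct hct' (isoOfRootedAut hφ).symm h
    have h1 : (isoOfRootedAut hφ).symm (φ v) = v := (isoOfRootedAut hφ).symm_apply_apply v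
    rwa [h1] at this
  have hdeg' : ∀ p, #{c | Child G r p c} ≤ 2 ^ m := fun p =>
    ((mk_le_mk_of_subset fun x hx => hx.1).trans
      (le_ciSup (f := fun v => #(G.neighborSet v)) bddAbove_of_small p)).trans hdeg
  obtain ⟨E, f, hET, hEc, hEmap, hf, hrig⟩ :=
    exists_rigid_trunk_coloring (hG := hG) (hinv := hinv) hm hmotion hdeg'
  -- The encoding is chosen for the set `S`, not for the vertex, so that `v` and `ψ v` share it.
  have henc := fun S : Set (TrunkColor hG r hinv) =>
    (show ∃ e : (ℕ → Prop × TrunkColor hG r hinv) → TrunkColor hG r hinv → TrunkColor hG r hinv,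
      ∀ κ, ℵ₀ ≤ κ → #S = 2 ^ κ → (∀ a t, (∀ n, (a n).2 ∈ S) → t ∈ S → e a t ∈ S) ∧
        ∀ a t a' t', (∀ n, (a n).2 ∈ S) → t ∈ S → (∀ n, (a' n).2 ∈ S) → t' ∈ S →
        e a t = e a' t' → a = a' ∧ t = t' by
      by_cases h : ∃ κ : Cardinal.{u}, ℵ₀ ≤ κ ∧ #S = 2 ^ κ
      · obtain ⟨κ, h1, h2⟩ := h
        obtain ⟨e, he⟩ := exists_encoding S h1 h2
        exact ⟨e, fun _ _ _ => he⟩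
      · exact ⟨fun _ t => t, fun κ h1 h2 => absurd ⟨κ, h1, h2⟩ h⟩)
  choose e he using henc
  have heE := fun v => he (E v) _ (self_le_add_right _ _) (hEc v)
  -- One colour at `v` carries the whole rigid sequence at `v` and the free parameter `t v`.
  let g : (∀ v, E v) → V → TrunkColor hG r hinv := fun t v => e (E v) (fun n => f n v) (t v)
  have hgE : ∀ t v, g t v ∈ E v := fun t v => (heE v).1 _ _ (fun n => hf n v) (t v).2
  have hgT : ∀ t v, (g t v).1 ∈ (hang hG r hinv).T True v := fun t v => hET v _ (hgE t v)
  -- With `t = t'` this shows that the painted set is asymmetrizing; in general it shows that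
  -- parameters differing on the trunk give inequivalent sets.
  have key : ∀ (t t' : ∀ v, E v) (ψ : G ≃g G), ψ '' paint (g t) = paint (g t') →
      ψ = SimpleGraph.Iso.refl ∧ ∀ v ∈ trunk G r, t v = t' v := by
    intro t t' ψ hψ
    have hψ' : ∀ x, x ∈ paint (g t) ↔ ψ x ∈ paint (g t') := fun x => by
      rw [← hψ, ψ.injective.mem_set_image]
    have hψr := apply_root_eq hc hc' hne hct hct' ψ hψ'
    have hψA : ψ.toEquiv ∈ rootedAut G r := ⟨hψr, fun u v => ψ.map_adj_iff⟩
    have hdec : ∀ v ∈ trunk G r, (fun n => f n (ψ v)) = (fun n => f n v) ∧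
        (t' (ψ v) : TrunkColor hG r hinv) = t v := by
      intro v hv
      have h1 : g t' (ψ v) = g t v := color_eq_of_paint (hgT t) (hgT t') hψA hψ' hv
      have h2 : E (ψ v) = E v := hEmap _ hψA v
      have h3 : ∀ n, (f n (ψ v)).2 ∈ E v := fun n => h2 ▸ hf n (ψ v)
      have h4 : (t' (ψ v)).1 ∈ E v := h2 ▸ (t' (ψ v)).2
      have h5 : g t' (ψ v) = e (E v) (fun n => f n (ψ v)) (t' (ψ v)) := by
        simp only [g, h2]
      rw [h5] at h1
      exact (heE v).2 _ _ _ _ h3 h4 (fun n => hf n v) (t v).2 h1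
    have hfix : ∀ v ∈ trunk G r, ψ v = v :=
      hrig _ hψA fun n v hv => congrFun (hdec v hv).1 n
    refine ⟨?_, fun v hv => Subtype.ext ?_⟩
    · ext x
      exact apply_eq_of_paint (hgT t) (hgT t') hψA hψ' hfix hr x
    · have h1 := (hdec v hv).2
      rw [hfix v hv] at h1
      exact h1.symm
  have hasym : ∀ t, IsAsymmetrizing G (paint (g t)) := fun t ψ hψ => (key t t ψ hψ).1
  have hEne : ∀ v, (E v).Nonempty := fun v => ⟨_, hf 0 v⟩
  classical
  let ext : (∀ v : trunk G r, E v) → ∀ v, E v := fun t v =>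
    if h : v ∈ trunk G r then t ⟨v, h⟩ else ⟨_, (hEne v).some_mem⟩
  have h1 : #(∀ v : trunk G r, E v) ≤ asymNumber G := by
    refine mk_le_of_injective (f := fun t => Quotient.mk (asymSetoid G) ⟨paint (g (ext t)), hasym _⟩)
      fun t t' h => ?_
    obtain ⟨ψ, hψ⟩ := Quotient.exact h
    funext ⟨v, hv⟩
    simpa [ext, hv] using (key _ _ ψ hψ).2 v hv
  refine le_trans ?_ h1
  have hsub : (Set.univ : Set V) ⊆ ⋃ v : trunk G r, {u | (hang hG r hinv).Desc v u} := by
    intro x _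
    obtain ⟨v, hv, hvx⟩ := exists_trunk_desc (hG := hG) (hinv := hinv) hr x
    exact Set.mem_iUnion.2 ⟨⟨v, hv⟩, hvx⟩
  have h2 : #V ≤ Cardinal.sum fun v : trunk G r => ℵ₀ + #(hangSet hG r hinv v) := by
    rw [← mk_univ]
    exact ((mk_le_mk_of_subset hsub).trans mk_iUnion_le_sum_mk).trans
      (sum_le_sum _ _ fun v => mk_hang_desc_le v.1)
  refine (power_le_power_left two_ne_zero h2).trans ?_
  rw [power_sum, mk_pi]
  exact prod_le_prod _ _ fun v => (hEc v).ge

end TreeAsym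

theorem theorem6 {V : Type u} (T : SimpleGraph V) (hT : T.IsTree)
    (m : Cardinal.{u}) (hm : ℵ₀ ≤ m)
    (hmotion : (m : WithTop Cardinal.{u}) ≤ TreeAsym.motion T)
    (hdeg : TreeAsym.maxDeg T ≤ 2 ^ m)
    (hray : TreeAsym.HasDoubleRay T) :
    TreeAsym.asymNumber T = 2 ^ #V :=
  (TreeAsym.asymNumber_le T).antisymm
    (TreeAsym.two_power_le_asymNumber hT hm hmotion hdeg hray)
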